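/- Let $n\ge 0$, $m\ge 0$, $p\ge 1$, let $f,g_1,\dots,g_m\in\mathbb{R}[x_1,\dots,x_n]$, and put $K=\{x\in\mathbb{R}^n : g_j(x)\ge 0,\ j=1,\dots,m\}$, $f_{\min}=\inf_{x\in K}f(x)$ (with $\inf\emptyset=+\infty$). Assume $f_{\min}>-\infty$. **Notation.** For a polynomial $r$ let $\deg r$ be its total degree ($\deg 0=0$), $r^{(\infty)}$ its homogeneous part of degree $\deg r$, and $\tilde r(x_0,x)=x_0^{\deg r}\,r(x/x_0)$ its homogenization. Write $\tilde x=(x_0,x_1,\dots,x_n)$, $d=\deg f$, and $\widetilde K=\{\tilde x\in\mathbb{R}^{n+1}: \tilde g_j(\tilde x)\ge 0\ (1\le j\le m),\ x_0\ge 0,\ \|\tilde x\|^2=1\}$. For a set $S$ of variables and an integer $e$, $\mathbb{R}[S]_e$ is the set of polynomials in the variables $S$ of degree at most $e$ (only $0$ if $e<0$), and $\Sigma[S]_e$ is the set of those that are sums of squares of polynomials in $\mathbb{R}[S]$. For finite families $h=(h_j)$, $g=(g_i)$ in $\mathbb{R}[S]$ let $$\mathrm{Ideal}[h,S]_{2k}=\sum_j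 h_j\,\mathbb{R}[S]_{2k-\deg h_j},\qquad \mathrm{QM}[g,S]_{2k}=\Sigma[S]_{2k}+\sum_i g_i\,\Sigma[S]_{2k-2\lceil \deg(g_i)/2\rceil}.$$ **Hypotheses.** 1. $K$ is closed at infinity: $\widetilde K$ equals the closure of $\widetilde K\cap\{x_0>0\}$. 2. $f^{(\infty)}$ is positive definite at infinity on $K$: $f^{(\infty)}(x)>0$ for every $x\in\mathbb{R}^n$ with $\|x\|=1$ and $g_j^{(\infty)}(x)\ge 0$ for $j=1,\dots,m$. 3. The problem has the correlative sparsity pattern $(\mathbf{x}(1),\dots,\mathbf{x}(p))$: these are subsets of $\{x_1,\dots,x_n\}$ with union $\{x_1,\dots,x_n\}$, one can write $f=f_1+\dots+f_p$ with $f_\ell\in\mathbb{R}[\mathbf{x}(\ell)]$, and each $g_j$ lies in $\mathbb{R}[\mathbf{x}(\ell)]$ for some $\ell$. **Relaxations.** Let $p_i$ be the number of $\ell$ with $x_i\in\mathbf{x}(\ell)$, let $w=(w_1,\dots,w_p)$ be new variables, $u=(\tilde x,w)$, and $$h'_\ell=\sum_{x_i\in\mathbf{x}(\ell)}\tfrac1{p_i}x_i^2+\tfrac1p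 x_0^2+w_\ell^2-1\quad(1\le \ell\le p),\qquad h'_{p+1}=\|w\|^2-(p-1).$$ Consider the reformulation: maximize $\gamma$ subject to $\tilde f(\tilde x)-\gamma x_0^d\ge 0$ on $$\widetilde K_s^2=\{(\tilde x,w)\in\mathbb{R}^{n+1+p}:\ x_0\ge 0,\ \tilde g_j(\tilde x)\ge 0\ (1\le j\le m),\ h'_\ell=0\ (1\le\ell\le p+1),\ 1-u_i^2\ge 0\ \text{for every variable } u_i\}.$$ Its csp graph has the variables $u$ as vertices, two distinct variables being adjacent if they occur in a common monomial of $\tilde f$ or in a common constraint polynomial ($x_0$, $\tilde g_j$, $h'_\ell$ or $1-u_i^2$). Take any chordal extension of this graph (a chordal graph on the same vertices containing all its edges) and let $\mathbf{u}(1),\dots,\mathbf{u}(q)$ be the list of all its maximal cliques. Let $\{J_1,\dots,J_q\}$ be any partition of $\{1,\dots,m\}$ and $\{I_1,\dots,I_q\}$ any partition of $\{1,\dots,p+1\}$ (empty blocks allowed) such that $g_j\in\mathbb{R}[\mathbf{u}(\ell)]$ for $j\in J_\ell$ and $h'_j\in\mathbb{R}[\mathbf{u}(\ell)]$ for $j\in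 I_\ell$. Let $\bar f_k\in[-\infty,+\infty]$ be the supremum of all $\gamma\in\mathbb{R}$ such that $$\tilde f-\gamma x_0^d\in\sum_{\ell=1}^q\mathrm{Ideal}\big[\{h'_j\}_{j\in I_\ell},\mathbf{u}(\ell)\big]_{2k}+\sum_{\ell=1}^q\mathrm{QM}\big[\{x_0\}\cup\{1-u_i^2\}_{u_i\in\mathbf{u}(\ell)}\cup\{\tilde g_j\}_{j\in J_\ell},\mathbf{u}(\ell)\big]_{2k}.$$ **Conclusion.** $\bar f_k\to f_{\min}$ as $k\to\infty$. -/

import Mathlib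

open MvPolynomial

noncomputable section

namespace SparsePOP

/-! ### Polynomials in a subset of the variables, truncated ideals and quadratic modules -/

section Truncations

variable {V : Type*}

/-- `ℝ[S]_e`: the polynomials that only involve variables from `S` and have total degree at most
`e`.  The bound `e` is an integer; for `e < 0` only the zero polynomial qualifies. -/
def polysLE (S : Set V) (e : ℤ) : Set (MvPolynomial V ℝ) :=
  {r | r ∈ supported ℝ S ∧ (r ≠ 0 → (r.totalDegree : ℤ) ≤ e)}

/-- `Σ[S]_e`: the sums of squares of polynomials in the variables `S`, of total degree at
most `e`. -/
def sosLE (S : Set V) (e : ℤ) : Set (MvPolynomial V ℝ) :=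
  {r | (∃ s : supported ℝ S, IsSumSq s ∧ (s : MvPolynomial V ℝ) = r) ∧ r ∈ polysLE S e}

/-- The degree `e` truncation, in `ℝ[S]`, of the ideal generated by the `h j`, `j ∈ T`:
all `∑ τ j * h j` with `τ j ∈ ℝ[S]_{e - deg (h j)}`. -/
def truncIdeal {ι : Type*} (S : Set V) (h : ι → MvPolynomial V ℝ) (T : Finset ι) (e : ℤ) :
    Set (MvPolynomial V ℝ) :=
  {r | ∃ τ : ι → MvPolynomial V ℝ,
    (∀ j ∈ T, τ j ∈ polysLE S (e - (h j).totalDegree)) ∧ r = ∑ j ∈ T, τ j * h j}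

/-- The degree `e` truncation (`e` even), in `ℝ[S]`, of the quadratic module generated by the
`g j`, `j ∈ T`: all `σ₀ + ∑ σ j * g j` with `σ₀ ∈ Σ[S]_e` and `σ j ∈ Σ[S]_{e - 2⌈deg (g j) / 2⌉}`.
The natural number `(deg + 1) / 2` is `⌈deg / 2⌉`. -/
def truncQModule {ι : Type*} (S : Set V) (g : ι → MvPolynomial V ℝ) (T : Finset ι) (e : ℤ) :
    Set (MvPolynomial V ℝ) :=
  {r | ∃ σ₀ : MvPolynomial V ℝ, ∃ σ : ι → MvPolynomial V ℝ,
    σ₀ ∈ sosLE S e ∧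
    (∀ j ∈ T, σ j ∈ sosLE S (e - 2 * (((g j).totalDegree + 1) / 2 : ℕ))) ∧
    r = σ₀ + ∑ j ∈ T, σ j * g j}

end Truncations

/-! ### Homogenization, closedness and positivity at infinity -/

/-- The homogenization `x₀ ^ deg f * f (x / x₀)`; the homogenizing variable has index `0`, and
the variable `i` becomes `i.succ`. -/
def homog {n : ℕ} (f : MvPolynomial (Fin n) ℝ) : MvPolynomial (Fin (n + 1)) ℝ :=
  ∑ i ∈ Finset.range (f.totalDegree + 1),
    X 0 ^ (f.totalDegree - i) * rename Fin.succ (homogeneousComponent i f)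

/-- The highest degree part `f^(∞)`. -/
def topForm {n : ℕ} (f : MvPolynomial (Fin n) ℝ) : MvPolynomial (Fin n) ℝ :=
  homogeneousComponent f.totalDegree f

/-- The feasible set `K`. -/
def feasibleSet {n m : ℕ} (g : Fin m → MvPolynomial (Fin n) ℝ) : Set (Fin n → ℝ) :=
  {x | ∀ j, 0 ≤ eval x (g j)}

/-- The optimal value `f_min` of minimizing `f` over `K`. -/
def fMin {n m : ℕ} (f : MvPolynomial (Fin n) ℝ) (g : Fin m → MvPolynomial (Fin n) ℝ) : EReal :=
  ⨅ x ∈ feasibleSet g, ((eval x f : ℝ) : EReal)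

/-- The homogenized set `K̃`. -/
def homogSet {n m : ℕ} (g : Fin m → MvPolynomial (Fin n) ℝ) : Set (Fin (n + 1) → ℝ) :=
  {y | (∀ j, 0 ≤ eval y (homog (g j))) ∧ 0 ≤ y 0 ∧ ∑ i, y i ^ 2 = 1}

/-- `K` is closed at infinity: `K̃ = cl (K̃ ∩ {x₀ > 0})`. -/
def ClosedAtInfinity {n m : ℕ} (g : Fin m → MvPolynomial (Fin n) ℝ) : Prop :=
  homogSet g = closure (homogSet g ∩ {y | 0 < y 0})

/-- `f^(∞) > 0` on
`K^(∞) = {x | ‖x‖² = 1 and g_j^(∞)(x) ≥ 0 for all j}`. -/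
def PositiveAtInfinity {n m : ℕ} (f : MvPolynomial (Fin n) ℝ)
    (g : Fin m → MvPolynomial (Fin n) ℝ) : Prop :=
  ∀ x : Fin n → ℝ, (∀ j, 0 ≤ eval x (topForm (g j))) → ∑ i, x i ^ 2 = 1 →
    0 < eval x (topForm f)

/-- `(x(1), …, x(p))` is a correlative sparsity pattern of the problem of minimizing `f` subject
to `g j ≥ 0`. -/
def IsCSP {n m p : ℕ} (f : MvPolynomial (Fin n) ℝ) (g : Fin m → MvPolynomial (Fin n) ℝ)
    (x : Fin p → Finset (Fin n)) : Prop :=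
  (∀ i, ∃ l, i ∈ x l) ∧
  (∃ F : Fin p → MvPolynomial (Fin n) ℝ,
    (∀ l, F l ∈ supported ℝ (x l : Set (Fin n))) ∧ f = ∑ l, F l) ∧
  (∃ J : Fin m → Fin p, ∀ j, g j ∈ supported ℝ (x (J j) : Set (Fin n)))

/-! ### The sparse homogenized reformulation -/

/-- The variables `u = (x₀, x₁, …, xₙ, w₁, …, w_p)` of the reformulation. -/
abbrev UVar (n p : ℕ) : Type := Fin (n + 1) ⊕ Fin p

/-- The homogenization `f̃`, as a polynomial in all the variables `u`. -/
def homogU {n : ℕ} (p : ℕ) (f : MvPolynomial (Fin n) ℝ) : MvPolynomial (UVar n p) ℝ :=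
  rename Sum.inl (homog f)

/-- The variable `x₀` among the variables `u`. -/
def x0 (n p : ℕ) : MvPolynomial (UVar n p) ℝ := X (Sum.inl 0)

/-- The number `p_i` of the sets `x(1), …, x(p)` that contain the variable `i`. -/
def freq {n p : ℕ} (x : Fin p → Finset (Fin n)) (i : Fin n) : ℕ :=
  (Finset.univ.filter fun l => i ∈ x l).card

/-- The polynomials of the equality constraints: for `some l` the weighted sphere
`∑_{i ∈ x(l)} x_i² / p_i + x₀² / p + w_l² - 1`, and for `none` the joint sphere
`‖w‖² - (p - 1)`. -/
def eqPoly {n p : ℕ} (x : Fin p → Finset (Fin n)) : Option (Fin p) → MvPolynomial (UVar n p) ℝ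
  | some l => ∑ i ∈ x l, C (1 / (freq x i : ℝ)) * X (Sum.inl i.succ) ^ 2
      + C (1 / (p : ℝ)) * x0 n p ^ 2 + X (Sum.inr l) ^ 2 - 1
  | none => ∑ l, X (Sum.inr l) ^ 2 - C ((p : ℝ) - 1)

/-- The polynomials of the inequality constraints `x₀ ≥ 0`, `1 - u_i² ≥ 0` (for every variable
`u_i`, in `x̃` or in `w`) and `g̃_j ≥ 0`. -/
def ineqPoly {n m : ℕ} (p : ℕ) (g : Fin m → MvPolynomial (Fin n) ℝ) :
    Unit ⊕ (UVar n p ⊕ Fin m) → MvPolynomial (UVar n p) ℝ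
  | .inl _ => x0 n p
  | .inr (.inl v) => 1 - X v ^ 2
  | .inr (.inr j) => homogU p (g j)

/-- The feasible set `K̃_s²` of the sparse homogenized reformulation. -/
def sparseHomogSet {n m p : ℕ} (g : Fin m → MvPolynomial (Fin n) ℝ)
    (x : Fin p → Finset (Fin n)) : Set (UVar n p → ℝ) :=
  {u | (∀ c, 0 ≤ eval u (ineqPoly p g c)) ∧ ∀ c, eval u (eqPoly x c) = 0}

/-- The correlative sparsity graph of the reformulation: two distinct variables are adjacent iff
they occur in a common monomial of the objective `f̃` or in a common constraint polynomial.
(The term `γ x₀^d` of the objective involves a single variable and contributes no edge.) -/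
def cspGraph {n m p : ℕ} (f : MvPolynomial (Fin n) ℝ) (g : Fin m → MvPolynomial (Fin n) ℝ)
    (x : Fin p → Finset (Fin n)) : SimpleGraph (UVar n p) where
  Adj a b := a ≠ b ∧
    ((∃ s ∈ (homogU p f).support, a ∈ s.support ∧ b ∈ s.support) ∨
      (∃ c, a ∈ (eqPoly x c).vars ∧ b ∈ (eqPoly x c).vars) ∨
      (∃ c, a ∈ (ineqPoly p g c).vars ∧ b ∈ (ineqPoly p g c).vars))
  symm := ⟨by
    rintro a b ⟨hne, h⟩
    refine ⟨hne.symm, ?_⟩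
    rcases h with ⟨s, hs, ha, hb⟩ | ⟨c, ha, hb⟩ | ⟨c, ha, hb⟩
    · exact Or.inl ⟨s, hs, hb, ha⟩
    · exact Or.inr (Or.inl ⟨c, hb, ha⟩)
    · exact Or.inr (Or.inr ⟨c, hb, ha⟩)⟩
  loopless := ⟨fun _ h => h.1 rfl⟩

/-- A graph is chordal if every cycle of length at least four has a chord, i.e. an edge of the
graph that joins two vertices of the cycle and is not an edge of the cycle. -/
def IsChordal {V : Type*} (G : SimpleGraph V) : Prop :=
  ∀ (v : V) (c : G.Walk v v), c.IsCycle → 4 ≤ c.length →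
    ∃ a ∈ c.support, ∃ b ∈ c.support, G.Adj a b ∧ s(a, b) ∉ c.edges

/-- `u(1), …, u(q)` is the list, without repetition, of all maximal cliques of `G`. -/
def IsMaxCliqueList {V : Type*} (G : SimpleGraph V) {q : ℕ} (u : Fin q → Finset V) : Prop :=
  Function.Injective u ∧ ∀ S : Set V, Maximal G.IsClique S ↔ ∃ l, (u l : Set V) = S

/-! ### The sparse sum-of-squares relaxations -/

/-- `γ` is feasible for the relaxation of order `k`:
`f̃ - γ x₀^d` lies in `∑_l Ideal[{h'_j}_{j ∈ I_l}, u(l)]_{2k}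
+ ∑_l QM[{x₀} ∪ {1 - u_i²}_{u_i ∈ u(l)} ∪ {g̃_j}_{j ∈ J_l}, u(l)]_{2k}`.
The partitions are given by the functions `I` and `J` that send an index to its block. -/
def SOSFeasible {n m p q : ℕ} (f : MvPolynomial (Fin n) ℝ) (g : Fin m → MvPolynomial (Fin n) ℝ)
    (x : Fin p → Finset (Fin n)) (u : Fin q → Finset (UVar n p))
    (J : Fin m → Fin q) (I : Option (Fin p) → Fin q) (k : ℕ) (γ : ℝ) : Prop :=
  ∃ a b : Fin q → MvPolynomial (UVar n p) ℝ,
    (∀ l, a l ∈ truncIdeal (u l : Set (UVar n p)) (eqPoly x)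
      (Finset.univ.filter fun c => I c = l) (2 * k)) ∧
    (∀ l, b l ∈ truncQModule (u l : Set (UVar n p)) (ineqPoly p g)
      (({()} : Finset Unit).disjSum ((u l).disjSum (Finset.univ.filter fun j => J j = l)))
      (2 * k)) ∧
    homogU p f - C γ * x0 n p ^ f.totalDegree = ∑ l, a l + ∑ l, b l

/-- The optimal value of the relaxation of order `k` (`⊥` if it is infeasible). -/
def sosValue {n m p q : ℕ} (f : MvPolynomial (Fin n) ℝ) (g : Fin m → MvPolynomial (Fin n) ℝ)
    (x : Fin p → Finset (Fin n)) (u : Fin q → Finset (UVar n p))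
    (J : Fin m → Fin q) (I : Option (Fin p) → Fin q) (k : ℕ) : EReal :=
  ⨆ γ ∈ {γ : ℝ | SOSFeasible f g x u J I k γ}, (γ : EReal)

end SparsePOP

end

/-!
The relaxations are bounded above by `f_min`, because every point of `K` lifts to a point of the
feasible set of the reformulation (`SOSFeasible.le_fMin`).  It remains to show that every
`γ < f_min` is feasible for all large orders, i.e. that `F = f̃ - γ x₀ ^ d` lies in the sum of the
ideals and quadratic modules of the cliques.  Positivity of `f^(∞)` at infinity makes `F` positive
on `K̃` (`homog_sub_pos`), hence on the feasible set of the reformulation, and the monomials of `F`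
live on cliques of the graph.  What is needed is therefore a sparse Positivstellensatz
(`sparseModule_of_pos`).  Its proof has three ingredients.

* Penalization.  All constraints other than `1 - u_i ^ 2 ≥ 0` are removed by subtracting from `F`
  terms `q (c) ^ 2 * c`, where `c ≥ 0` is a constraint and `q` a univariate polynomial, so that the
  result is positive on the whole cube `[-1, 1] ^ V` (`exists_penalties`).  Each such term only
  involves the variables of `c`, so it respects the sparsity and belongs to the quadratic module, or
  to the ideal, of one clique.

* Splitting.  A chordal graph has a simplicial vertex (`IsChordal.exists_simplicial`).  Eliminating
  such vertices one by one writes a polynomial that is positive on the cube and sparse for the graph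
  as a sum of polynomials that are positive on the cube and involve the variables of a single clique
  (`IsChordal.induction_on_positive`).

* Putinar's theorem for the cube (`mem_cubeQM_of_pos`).  If `F` were not in the quadratic module `M`
  generated by the `1 - X i ^ 2`, the Riesz extension theorem would give a functional `L` with
  `L 1 = 1` that is nonnegative on `M` and has `L F ≤ 0`.  Log-convexity of moments shows that the
  polynomials which preserve positivity for `L` under multiplication, a semiring, contain
  `1 - X i ^ 2` and hence `1 ± X i` (`LPos.mul_one_sub_sq`).  A semiring that contains these and the
  squares contains all polynomials positive on the cube (`mem_of_pos_on_cube`): expand `F` along the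
  partition of unity formed by the products of Bernstein polynomials, and bound the deviation of `F`
  from its value at a node by a quadratic polynomial whose average is small.
-/

namespace SparsePOP

/-! ### Simplicial vertices of chordal graphs -/

section Chordal

variable {V : Type*} {G : SimpleGraph V}

/-- A shortest walk has no chord. -/
theorem mem_edges_of_length_eq_dist {s t : V} (p : G.Walk s t) (hp : p.length = G.dist s t)
    {a b : V} (ha : a ∈ p.support) (hb : b ∈ p.support) (hab : G.Adj a b) :
    s(a, b) ∈ p.edges := by
  obtain ⟨i, rfl, hi⟩ := SimpleGraph.Walk.mem_support_iff_exists_getVert.mp ha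
  obtain ⟨j, rfl, hj⟩ := SimpleGraph.Walk.mem_support_iff_exists_getVert.mp hb
  wlog hij : i ≤ j generalizing i j
  · rw [Sym2.eq_swap]
    exact this j hj hb i hi ha hab.symm (by omega)
  have hne : i ≠ j := fun h => hab.ne (by rw [h])
  have hshort := G.dist_le (((p.take i).concat hab).append (p.drop j))
  simp only [SimpleGraph.Walk.length_append, SimpleGraph.Walk.length_concat,
    SimpleGraph.Walk.take_length, SimpleGraph.Walk.drop_length] at hshort
  obtain rfl : j = i + 1 := by omega
  exact (SimpleGraph.Walk.mk_mem_edges_iff_exists p).2 ⟨i, by omega, rfl⟩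

/-- In a chordal graph, let `s` and `t` be neighbours of `x` that are joined by a walk through `W`,
where `s` and `t` are the only vertices of `W` in the closed neighbourhood of `x`.  Then `s` and `t`
are adjacent: otherwise a shortest such walk and `x` would form a cycle without chord. -/
theorem IsChordal.adj_of_reachable (hG : IsChordal G) {x s t : V} (hs : G.Adj x s)
    (ht : G.Adj x t) (hst : s ≠ t) (W : Set V) (hW : ∀ c ∈ W, c ≠ x ∧ (G.Adj x c → c = s ∨ c = t))
    (hreach : (SimpleGraph.fromRel fun a b => G.Adj a b ∧ a ∈ W ∧ b ∈ W).Reachable s t) :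
    G.Adj s t := by
  classical
  by_contra hnadj
  set H : SimpleGraph V := SimpleGraph.fromRel fun a b => G.Adj a b ∧ a ∈ W ∧ b ∈ W with hH
  have hHadj : ∀ a b, H.Adj a b ↔ G.Adj a b ∧ a ∈ W ∧ b ∈ W := by
    intro a b
    simp only [hH, SimpleGraph.fromRel_adj]
    constructor
    · rintro ⟨-, h | h⟩
      · exact h
      · exact ⟨h.1.symm, h.2.2, h.2.1⟩
    · exact fun h => ⟨h.1.ne, Or.inl h⟩
  have hle : H ≤ G := fun a b h => ((hHadj a b).1 h).1
  obtain ⟨p, hp, hlen⟩ := hreach.exists_path_of_dist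
  have hlong : 1 < H.dist s t :=
    hreach.one_lt_dist_of_ne_of_not_adj hst fun h => hnadj (hle h)
  have hsupp : ∀ c ∈ p.support, c ∈ W := by
    intro c hc
    have hnn : ¬ p.Nil := SimpleGraph.Walk.not_nil_of_ne hst
    obtain ⟨e, he, hce⟩ := (SimpleGraph.Walk.mem_support_iff_exists_mem_edges_of_not_nil hnn).1 hc
    induction e with
    | _ a b =>
      have := (hHadj a b).1 (p.adj_of_mem_edges he)
      rcases Sym2.mem_iff.1 hce with rfl | rfl
      · exact this.2.1
      · exact this.2.2
  have hx : x ∉ (p.mapLe hle).support := by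
    rw [SimpleGraph.Walk.support_mapLe_eq_support]
    exact fun h => (hW x (hsupp x h)).1 rfl
  have hcyc : (SimpleGraph.Walk.cons hs ((p.mapLe hle).concat ht.symm)).IsCycle := by
    rw [SimpleGraph.Walk.cons_isCycle_iff, SimpleGraph.Walk.concat_isPath_iff]
    refine ⟨⟨hp.mapLe hle, hx⟩, ?_⟩
    rw [SimpleGraph.Walk.edges_concat]
    intro h
    rw [List.concat_eq_append, List.mem_append, List.mem_singleton] at h
    rcases h with h | h
    · exact hx ((p.mapLe hle).fst_mem_support_of_mem_edges h)
    · rcases Sym2.eq_iff.1 h with ⟨h, -⟩ | ⟨-, h⟩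
      · exact ht.ne h
      · exact hst h
  obtain ⟨a, ha, b, hb, hab, hnot⟩ := hG x _ hcyc (by simp; omega)
  simp only [SimpleGraph.Walk.support_cons, SimpleGraph.Walk.support_concat,
    SimpleGraph.Walk.edges_cons, SimpleGraph.Walk.edges_concat, List.mem_cons, List.mem_append,
    List.concat_eq_append, List.not_mem_nil, or_false,
    SimpleGraph.Walk.support_mapLe_eq_support, SimpleGraph.Walk.edges_mapLe_eq_edges] at ha hb hnot
  have key : ∀ c, c ∈ p.support → G.Adj x c → c = s ∨ c = t := fun c hc h =>
    (hW c (hsupp c hc)).2 h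
  have hxedge : ∀ c, c ∈ p.support → G.Adj x c →
      s(x, c) = s(x, s) ∨ s(x, c) ∈ p.edges ∨ s(x, c) = s(t, x) := by
    intro c hc h
    rcases key c hc h with rfl | rfl
    · exact Or.inl rfl
    · exact Or.inr (Or.inr Sym2.eq_swap)
  have ha' : a = x ∨ a ∈ p.support := by tauto
  have hb' : b = x ∨ b ∈ p.support := by tauto
  rcases ha' with rfl | ha'
  · rcases hb' with rfl | hb'
    · exact hab.ne rfl
    · exact hnot (hxedge b hb' hab)
  · rcases hb' with rfl | hb'
    · rw [Sym2.eq_swap] at hnot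
      exact hnot (hxedge a ha' hab.symm)
    · exact hnot (Or.inr (Or.inl (mem_edges_of_length_eq_dist p hlen ha' hb'
        ((hHadj a b).2 ⟨hab, hsupp a ha', hsupp b hb'⟩))))

/-- Dirac's lemma in relative form: if `G` is chordal and `K` is a clique properly contained in `A`,
then `A \ K` has a vertex whose neighbours in `A` form a clique. -/
theorem IsChordal.exists_simplicial [DecidableEq V] (hG : IsChordal G) (A : Finset V) :
    ∀ K : Finset V, K ⊂ A → G.IsClique K →
      ∃ v ∈ A, v ∉ K ∧ G.IsClique {c | c ∈ A ∧ G.Adj v c} := by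
  classical
  induction A using Finset.strongInduction with
  | H A ih =>
  intro K hKA hK
  by_cases hA : G.IsClique A
  · obtain ⟨v, hvA, hvK⟩ := Finset.exists_of_ssubset hKA
    exact ⟨v, hvA, hvK, hA.subset fun c hc => hc.1⟩
  -- a vertex `x` of `A`, not adjacent to all of `A`, whose non-neighbours avoid `K`
  obtain ⟨x, hxA, y, hyA, hxy, hnxy, hxK⟩ : ∃ x ∈ A, ∃ y ∈ A, x ≠ y ∧ ¬ G.Adj x y ∧
      ∀ c ∈ A, c ≠ x → ¬ G.Adj x c → c ∉ K := by
    by_cases h : ∃ x ∈ K, ∃ y ∈ A, x ≠ y ∧ ¬ G.Adj x y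
    · obtain ⟨x, hxK, y, hyA, hxy, hn⟩ := h
      exact ⟨x, hKA.1 hxK, y, hyA, hxy, hn, fun c _ hcx hc hcK => hc (hK hxK hcK hcx.symm)⟩
    · push Not at h
      obtain ⟨x, hxA, y, hyA, hxy, hn⟩ : ∃ x ∈ A, ∃ y ∈ A, x ≠ y ∧ ¬ G.Adj x y := by
        by_contra hcon
        push Not at hcon
        exact hA fun a ha b hb hab => hcon a ha b hb hab
      exact ⟨x, hxA, y, hyA, hxy, hn, fun c _ hcx hc hcK => hc (h c hcK x hxA hcx).symm⟩
  -- the component `C` of `y` among the vertices of `A` off the closed neighbourhood of `x`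
  set D : Set V := {c | c ∈ A ∧ c ≠ x ∧ ¬ G.Adj x c} with hD
  set R : SimpleGraph V := SimpleGraph.fromRel fun a b => G.Adj a b ∧ a ∈ D ∧ b ∈ D with hR
  set C : Finset V := A.filter fun c => c ∈ D ∧ R.Reachable y c with hC
  -- and its neighbours `S` in `A`
  set S : Finset V := A.filter fun s => G.Adj x s ∧ ∃ c ∈ C, G.Adj s c with hS
  have hyC : y ∈ C := by
    simp only [hC, hD, Finset.mem_filter, Set.mem_ofPred_eq]
    exact ⟨hyA, ⟨hyA, hxy.symm, hnxy⟩, SimpleGraph.Reachable.refl _⟩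
  have hdisj : ∀ c ∈ C, c ∉ S := by
    intro c hc hcS
    exact (Finset.mem_filter.1 hc).2.1.2.2 (Finset.mem_filter.1 hcS).2.1
  have hnbr : ∀ v ∈ C, ∀ c ∈ A, G.Adj v c → c ∈ C ∪ S := by
    intro v hv c hc hvc
    have hv' := (Finset.mem_filter.1 hv).2
    rw [Finset.mem_union]
    by_cases hxc : G.Adj x c
    · exact Or.inr (Finset.mem_filter.2 ⟨hc, hxc, v, hv, hvc.symm⟩)
    · have hcx : c ≠ x := fun h => hv'.1.2.2 (h ▸ hvc.symm)
      have hcD : c ∈ D := ⟨hc, hcx, hxc⟩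
      refine Or.inl (Finset.mem_filter.2 ⟨hc, hcD, hv'.2.trans ?_⟩)
      exact SimpleGraph.Adj.reachable
        ((SimpleGraph.fromRel_adj _ _ _).2 ⟨hvc.ne, Or.inl ⟨hvc, hv'.1, hcD⟩⟩)
  have hSclique : G.IsClique (S : Set V) := by
    intro s hs t ht hst
    obtain ⟨-, hxs, c, hcC, hsc⟩ := Finset.mem_filter.1 (Finset.mem_coe.1 hs)
    obtain ⟨-, hxt, d, hdC, htd⟩ := Finset.mem_filter.1 (Finset.mem_coe.1 ht)
    have hc' := (Finset.mem_filter.1 hcC).2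
    have hd' := (Finset.mem_filter.1 hdC).2
    refine hG.adj_of_reachable hxs hxt hst (insert s (insert t D)) ?_ ?_
    · rintro c (rfl | rfl | h)
      · exact ⟨hxs.ne', fun _ => Or.inl rfl⟩
      · exact ⟨hxt.ne', fun _ => Or.inr rfl⟩
      · exact ⟨h.2.1, fun h' => (h.2.2 h').elim⟩
    · have h1 : R.Reachable c d := hc'.2.symm.trans hd'.2
      refine SimpleGraph.Reachable.trans
        (SimpleGraph.Adj.reachable ((SimpleGraph.fromRel_adj _ _ _).2
        ⟨hsc.ne, Or.inl ⟨hsc, by simp, by simp [hc'.1]⟩⟩)) (SimpleGraph.Reachable.trans (h1.mono ?_)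
        (SimpleGraph.Adj.reachable ((SimpleGraph.fromRel_adj _ _ _).2
        ⟨htd.ne', Or.inl ⟨htd.symm, by simp [hd'.1], by simp⟩⟩)))
      intro a b hab
      rw [hR, SimpleGraph.fromRel_adj] at hab
      rw [SimpleGraph.fromRel_adj]
      rcases hab with ⟨hne, ⟨h1, h2, h3⟩ | ⟨h1, h2, h3⟩⟩
      · exact ⟨hne, Or.inl ⟨h1, Or.inr (Or.inr h2), Or.inr (Or.inr h3)⟩⟩
      · exact ⟨hne, Or.inr ⟨h1, Or.inr (Or.inr h2), Or.inr (Or.inr h3)⟩⟩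
  have hsub : C ∪ S ⊂ A := by
    refine Finset.ssubset_iff_subset_ne.2 ⟨?_, ?_⟩
    · exact Finset.union_subset (Finset.filter_subset _ _) (Finset.filter_subset _ _)
    · intro h
      rw [← h, Finset.mem_union] at hxA
      rcases hxA with hxA | hxA
      · exact (Finset.mem_filter.1 hxA).2.1.2.1 rfl
      · exact (Finset.mem_filter.1 hxA).2.1.ne rfl
  have hSsub : S ⊂ C ∪ S := Finset.ssubset_iff_subset_ne.2 ⟨Finset.subset_union_right,
    fun h => hdisj y hyC (by rw [h]; exact Finset.mem_union_left _ hyC)⟩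
  obtain ⟨v, hv, hvS, hvcl⟩ := ih _ hsub S hSsub hSclique
  have hvC : v ∈ C := (Finset.mem_union.1 hv).resolve_right hvS
  obtain ⟨hvA, hvD, -⟩ := Finset.mem_filter.1 hvC
  refine ⟨v, hvA, hxK v hvA hvD.2.1 hvD.2.2, Set.Pairwise.mono ?_ hvcl⟩
  rintro c ⟨hcA, hvc⟩
  exact ⟨hnbr v hvC c hcA hvc, hvc⟩

end Chordal

/-! ### Polynomials positive on the cube belong to semirings that contain `1 ± X i` and squares -/

section Semiring

variable {σ : Type*}

theorem C_half_mul_two : (C (1 / 2) : MvPolynomial σ ℝ) * 2 = 1 := by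
  rw [← map_ofNat (C : ℝ →+* MvPolynomial σ ℝ) 2, ← C_mul]
  norm_num

/-- The Bernstein polynomials of degree `N`, transported to the interval `[-1, 1]`. -/
noncomputable def bernPoly (N : ℕ) (i : σ) (a : Fin (N + 1)) : MvPolynomial σ ℝ :=
  Polynomial.aeval (C (1 / 2) * (1 + X i)) (bernsteinPolynomial ℝ N a)

/-- The nodes `2 a / N - 1`, `0 ≤ a ≤ N`, of the interval `[-1, 1]`. -/
noncomputable def bernNode (N : ℕ) (a : Fin (N + 1)) : ℝ := 2 * (a : ℝ) / N - 1

theorem abs_bernNode_le {N : ℕ} (hN : 0 < N) (a : Fin (N + 1)) : |bernNode N a| ≤ 1 := by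
  have hN' : (0 : ℝ) < N := by exact_mod_cast hN
  have ha : (a : ℝ) ≤ N := by exact_mod_cast Nat.lt_succ_iff.1 a.2
  have ha0 : (0 : ℝ) ≤ (a : ℝ) := by positivity
  unfold bernNode
  rw [abs_le]
  constructor
  · have : 0 ≤ 2 * (a : ℝ) / N := by positivity
    linarith
  · have : 2 * (a : ℝ) / N ≤ 2 := by
      rw [div_le_iff₀ hN']
      linarith
    linarith

theorem sum_bernPoly (N : ℕ) (i : σ) : ∑ a, bernPoly N i a = 1 := by
  have h := congrArg (Polynomial.aeval (C (1 / 2) * (1 + X i) : MvPolynomial σ ℝ))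
    (bernsteinPolynomial.sum ℝ N)
  rw [map_sum, map_one, Finset.sum_range] at h
  exact h

theorem sum_bernPoly_mul_sq {N : ℕ} (hN : 0 < N) (i : σ) :
    ∑ a, bernPoly N i a * (X i - C (bernNode N a)) ^ 2 = C (1 / (N : ℝ)) * (1 - X i ^ 2) := by
  have h := congrArg (Polynomial.aeval (C (1 / 2) * (1 + X i) : MvPolynomial σ ℝ))
    (bernsteinPolynomial.variance ℝ N)
  have hN' : (N : ℝ) ≠ 0 := by exact_mod_cast hN.ne'
  have hC : C (1 / (N : ℝ)) * (N : MvPolynomial σ ℝ) = 1 := by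
    rw [← C_eq_coe_nat, ← C_mul, one_div, inv_mul_cancel₀ hN', C_1]
  have h2 : (C (1 / 2) : MvPolynomial σ ℝ) * 2 = 1 := C_half_mul_two
  rw [map_sum, Finset.sum_range] at h
  simp only [map_mul, map_pow, map_sub, map_one, Polynomial.aeval_X, map_nsmul, map_natCast] at h
  have h3 : ∀ a : Fin (N + 1), (X i - C (bernNode N a) : MvPolynomial σ ℝ) =
      2 * C (1 / (N : ℝ)) * (N • (C (1 / 2) * (1 + X i)) - ((a : ℕ) : MvPolynomial σ ℝ)) := by
    intro a
    have : (C (bernNode N a) : MvPolynomial σ ℝ) =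
        2 * ((a : ℕ) : MvPolynomial σ ℝ) * C (1 / (N : ℝ)) - 1 := by
      rw [bernNode, C_sub, div_eq_mul_one_div, C_mul, C_mul, C_1, map_ofNat, C_eq_coe_nat]
    rw [this, nsmul_eq_mul]
    linear_combination (-(1 + X i)) * hC * (2 * C (1 / 2)) - (1 + X i) * h2
  calc ∑ a, bernPoly N i a * (X i - C (bernNode N a)) ^ 2
      = 4 * C (1 / (N : ℝ)) ^ 2 * ∑ a : Fin (N + 1),
          (N • (C (1 / 2) * (1 + X i)) - ((a : ℕ) : MvPolynomial σ ℝ)) ^ 2 *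
          Polynomial.aeval (C (1 / 2) * (1 + X i)) (bernsteinPolynomial ℝ N a) := by
        rw [Finset.mul_sum]
        refine Finset.sum_congr rfl fun a _ => ?_
        rw [h3, bernPoly]
        ring
    _ = _ := by
        rw [h, nsmul_eq_mul]
        have e1 : (C (1 / (N : ℝ)) : MvPolynomial σ ℝ) ^ 2 * (N : MvPolynomial σ ℝ) =
            C (1 / (N : ℝ)) := by
          linear_combination C (1 / (N : ℝ)) * hC
        have e2 : (4 : MvPolynomial σ ℝ) * (C (1 / 2) * (1 + X i)) * (1 - C (1 / 2) * (1 + X i))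
            = 1 - X i ^ 2 := by
          linear_combination (2 * (1 + X i) - (1 + X i) ^ 2 * (C (1 / 2) * 2 + 1)) * h2
        linear_combination (4 * (C (1 / 2) * (1 + X i)) * (1 - C (1 / 2) * (1 + X i))) * e1 +
          C (1 / (N : ℝ)) * e2

variable {P : Subsemiring (MvPolynomial σ ℝ)}

theorem bernPoly_mem (hC : ∀ c : ℝ, 0 ≤ c → C c ∈ P) (hX : ∀ i, 1 + X i ∈ P)
    (hX' : ∀ i, 1 - X i ∈ P) (N : ℕ) (i : σ) (a : Fin (N + 1)) : bernPoly N i a ∈ P := by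
  have h : bernPoly N i a = (N.choose a : MvPolynomial σ ℝ) * (C (1 / 2) * (1 + X i)) ^ (a : ℕ) *
      (C (1 / 2) * (1 - X i)) ^ (N - a) := by
    have h2 : (1 : MvPolynomial σ ℝ) = C (1 / 2) * (1 + X i) + C (1 / 2) * (1 - X i) := by
      linear_combination -C_half_mul_two (σ := σ)
    simp only [bernPoly, bernsteinPolynomial, map_mul, map_pow, map_sub, map_one,
      Polynomial.aeval_X, map_natCast]
    rw [sub_eq_of_eq_add' h2]
  rw [h]
  exact mul_mem (mul_mem (natCast_mem _ _) (pow_mem (mul_mem (hC _ (by norm_num)) (hX i)) _))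
    (pow_mem (mul_mem (hC _ (by norm_num)) (hX' i)) _)

variable [Fintype σ]

/-- A quadratic bound for `|X - ν|` that tends to `0` with `ε` near `ν`. -/
noncomputable def quadBound (ν : σ → ℝ) (ε : ℝ) : MvPolynomial σ ℝ :=
  C ε + ∑ i, C (1 / ε) * (X i - C (ν i)) ^ 2

/-- In the order given by `P`, every polynomial `F` satisfies `|F - F(ν)| ≤ D * quadBound ν ε`, with
a constant `D` that depends on neither the point `ν` of the cube nor `ε`. -/
theorem exists_quadBound (hC : ∀ c : ℝ, 0 ≤ c → C c ∈ P) (hsq : ∀ r, r ^ 2 ∈ P)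
    (hX : ∀ i, 1 + X i ∈ P) (hX' : ∀ i, 1 - X i ∈ P) (F : MvPolynomial σ ℝ) :
    ∃ D : ℝ, 0 ≤ D ∧ ∀ (ν : σ → ℝ) (ε : ℝ), (∀ i, |ν i| ≤ 1) → 0 < ε → |eval ν F| ≤ D ∧
      C D * quadBound ν ε + (F - C (eval ν F)) ∈ P ∧
      C D * quadBound ν ε - (F - C (eval ν F)) ∈ P := by
  have hE : ∀ (ν : σ → ℝ) (ε : ℝ), 0 < ε → quadBound ν ε ∈ P := fun ν ε hε =>
    add_mem (hC _ hε.le) (sum_mem fun i _ => mul_mem (hC _ (by positivity)) (hsq _))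
  induction F using MvPolynomial.induction_on with
  | C a =>
    refine ⟨|a|, abs_nonneg _, fun ν ε _ hε => ⟨by simp, ?_, ?_⟩⟩ <;>
    · simp only [eval_C, sub_self, add_zero, sub_zero]
      exact mul_mem (hC _ (abs_nonneg _)) (hE ν ε hε)
  | add p q hp hq =>
    obtain ⟨D, hD, hp⟩ := hp
    obtain ⟨D', hD', hq⟩ := hq
    refine ⟨D + D', by positivity, fun ν ε hν hε => ?_⟩
    obtain ⟨h1, h2, h3⟩ := hp ν ε hν hε
    obtain ⟨k1, k2, k3⟩ := hq ν ε hν hε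
    refine ⟨?_, ?_, ?_⟩
    · rw [eval_add]
      exact (abs_add_le _ _).trans (add_le_add h1 k1)
    · convert! add_mem h2 k2 using 1
      rw [C_add, eval_add, C_add]
      ring
    · convert! add_mem h3 k3 using 1
      rw [C_add, eval_add, C_add]
      ring
  | mul_X p i hp =>
    obtain ⟨D, hD, hp⟩ := hp
    refine ⟨2 * D, by positivity, fun ν ε hν hε => ?_⟩
    obtain ⟨h1, h2, h3⟩ := hp ν ε hν hε
    have hhalf : (C (1 / 2) : MvPolynomial σ ℝ) * 2 = 1 := C_half_mul_two
    have hhalfP : (C (1 / 2) : MvPolynomial σ ℝ) ∈ P := hC _ (by norm_num)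
    -- `(p - p(ν)) X i` is bounded like `p - p(ν)`, because `1 ± X i ∈ P`
    have m1 : C D * quadBound ν ε + (p - C (eval ν p)) * X i ∈ P := by
      convert! mul_mem hhalfP (add_mem (mul_mem h2 (hX i)) (mul_mem h3 (hX' i))) using 1
      linear_combination -(C D * quadBound ν ε + (p - C (eval ν p)) * X i) * hhalf
    have m2 : C D * quadBound ν ε - (p - C (eval ν p)) * X i ∈ P := by
      convert! mul_mem hhalfP (add_mem (mul_mem h2 (hX' i)) (mul_mem h3 (hX i))) using 1
      linear_combination -(C D * quadBound ν ε - (p - C (eval ν p)) * X i) * hhalf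
    -- completing the square: `quadBound ν ε ± 2 (X i - ν i) ∈ P`
    have hEi : ∀ s : ℝ, s ^ 2 = 1 → quadBound ν ε + C (2 * s) * (X i - C (ν i)) ∈ P := by
      classical
      intro s hs
      have e : quadBound ν ε + C (2 * s) * (X i - C (ν i)) =
          C (1 / ε) * (C (ε * s) + (X i - C (ν i))) ^ 2 +
            ∑ j ∈ Finset.univ.erase i, C (1 / ε) * (X j - C (ν j)) ^ 2 := by
        rw [quadBound, ← Finset.add_sum_erase _ _ (Finset.mem_univ i)]
        have e1 : (C (1 / ε) * C (ε * s) ^ 2 : MvPolynomial σ ℝ) = C ε := by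
          rw [← C_pow, ← C_mul]
          congr 1
          rw [mul_pow, hs]
          field_simp
        have e2 : (C (1 / ε) * C (ε * s) * 2 : MvPolynomial σ ℝ) = C (2 * s) := by
          rw [← map_ofNat (C : ℝ →+* MvPolynomial σ ℝ) 2, ← C_mul, ← C_mul]
          congr 1
          field_simp
        linear_combination -e1 - (X i - C (ν i)) * e2
      rw [e]
      exact add_mem (mul_mem (hC _ (by positivity)) (hsq _))
        (sum_mem fun j _ => mul_mem (hC _ (by positivity)) (hsq _))
    have hlin : ∀ c : ℝ, |c| ≤ D → C D * quadBound ν ε + C c * (X i - C (ν i)) ∈ P := by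
      intro c hc
      obtain ⟨s, hs, hcs⟩ : ∃ s : ℝ, s ^ 2 = 1 ∧ c = |c| * s := by
        rcases le_total 0 c with h | h
        · exact ⟨1, by norm_num, by rw [abs_of_nonneg h, mul_one]⟩
        · exact ⟨-1, by norm_num, by rw [abs_of_nonpos h]; ring⟩
      have h0 := abs_nonneg c
      convert! add_mem (mul_mem (hC (D - |c| / 2) (by linarith)) (hE ν ε hε))
        (mul_mem (hC (|c| / 2) (by positivity)) (hEi s hs)) using 1
      have e : (C c : MvPolynomial σ ℝ) = C (|c| / 2) * C (2 * s) := by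
        rw [← C_mul]
        congr 1
        linarith
      rw [e, C_sub]
      ring
    have m3 := hlin _ h1
    have m4 := hlin (-eval ν p) (by rwa [abs_neg])
    refine ⟨?_, ?_, ?_⟩
    · rw [eval_mul, eval_X, abs_mul]
      nlinarith [abs_nonneg (eval ν p), hν i, abs_nonneg (ν i)]
    · convert! add_mem m1 m3 using 1
      rw [eval_mul, eval_X, C_mul, C_mul, map_ofNat (C : ℝ →+* MvPolynomial σ ℝ) 2]
      ring
    · convert! add_mem m2 m4 using 1
      rw [eval_mul, eval_X, C_mul, C_mul, map_ofNat (C : ℝ →+* MvPolynomial σ ℝ) 2, C_neg]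
      ring

/-- A Positivstellensatz for semirings: a polynomial that is positive on `[-1, 1] ^ σ` belongs to
any semiring that contains the nonnegative constants, the squares and all `1 ± X i`. -/
theorem mem_of_pos_on_cube (hC : ∀ c : ℝ, 0 ≤ c → C c ∈ P) (hsq : ∀ r, r ^ 2 ∈ P)
    (hX : ∀ i, 1 + X i ∈ P) (hX' : ∀ i, 1 - X i ∈ P) (F : MvPolynomial σ ℝ) {δ : ℝ} (hδ : 0 < δ)
    (hF : ∀ x : σ → ℝ, (∀ i, |x i| ≤ 1) → δ ≤ eval x F) : F ∈ P := by
  classical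
  obtain ⟨D, hD, hbound⟩ := exists_quadBound hC hsq hX hX' F
  -- `D ε` and `D |σ| / (ε N)` are at most `δ / 2`
  set ε : ℝ := δ / (2 * (D + 1)) with hε
  have hε0 : 0 < ε := by positivity
  obtain ⟨N, hN⟩ := exists_nat_gt (max 0 (D * (1 / ε) * Fintype.card σ * (2 / δ)))
  have hN0 : (0 : ℝ) < N := (le_max_left _ _).trans_lt hN
  have hNpos : 0 < N := by exact_mod_cast hN0
  set B : (σ → Fin (N + 1)) → MvPolynomial σ ℝ := fun α => ∏ i, bernPoly N i (α i) with hB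
  set ν : (σ → Fin (N + 1)) → σ → ℝ := fun α i => bernNode N (α i) with hν
  have hBP : ∀ α, B α ∈ P := fun α => prod_mem fun i _ => bernPoly_mem hC hX hX' N i _
  have hBsum : ∑ α, B α = 1 := by
    rw [hB, ← Fintype.prod_sum]
    exact Finset.prod_eq_one fun i _ => sum_bernPoly N i
  have hBvar : ∀ i, ∑ α, B α * (X i - C (ν α i)) ^ 2 = C (1 / (N : ℝ)) * (1 - X i ^ 2) := by
    intro i
    have h : ∀ α : σ → Fin (N + 1), B α * (X i - C (ν α i)) ^ 2 =
        ∏ j, bernPoly N j (α j) * (if j = i then (X i - C (bernNode N (α j))) ^ 2 else 1) := by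
      intro α
      rw [Finset.prod_mul_distrib, Finset.prod_ite_eq' Finset.univ i]
      simp [hB, hν]
    rw [Finset.sum_congr rfl fun α _ => h α, ← Fintype.prod_sum fun j a =>
      bernPoly N j a * (if j = i then (X i - C (bernNode N a)) ^ 2 else 1),
      Finset.prod_eq_single i]
    · simp only [if_true]
      exact sum_bernPoly_mul_sq hNpos i
    · intro j _ hj
      simp only [hj, if_false, mul_one]
      exact sum_bernPoly N j
    · simp
  have hνcube : ∀ α i, |ν α i| ≤ 1 := fun α i => abs_bernNode_le hNpos _
  -- average of the quadratic bounds over the nodes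
  have hquad : ∑ α, B α * quadBound (ν α) ε =
      C ε + ∑ i : σ, C (1 / ε * (1 / N)) * (1 - X i ^ 2) := by
    simp only [quadBound, mul_add, Finset.sum_add_distrib, Finset.mul_sum]
    rw [← Finset.sum_mul, hBsum, one_mul, Finset.sum_comm]
    congr 1
    refine Finset.sum_congr rfl fun i _ => ?_
    rw [C_mul, mul_assoc, ← hBvar i, Finset.mul_sum]
    exact Finset.sum_congr rfl fun α _ => by ring
  have h1 : ∑ α, B α * (C D * quadBound (ν α) ε + (F - C (eval (ν α) F))) ∈ P :=
    sum_mem fun α _ => mul_mem (hBP α) (hbound (ν α) ε (hνcube α) hε0).2.1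
  have h2 : ∑ α, B α * C (eval (ν α) F - δ) ∈ P :=
    sum_mem fun α _ => mul_mem (hBP α) (hC _ (sub_nonneg.2 (hF _ (hνcube α))))
  have h3 : ∑ i : σ, C (D * (1 / ε * (1 / N))) * X i ^ 2 ∈ P :=
    sum_mem fun i _ => mul_mem (hC _ (by positivity)) (hsq _)
  set c : ℝ := δ - D * ε - D * (1 / ε * (1 / N)) * Fintype.card σ with hc
  have hc0 : 0 ≤ c := by
    have i1 : D * ε ≤ δ / 2 := by
      rw [hε, mul_div_assoc', div_le_div_iff₀ (by positivity) (by norm_num)]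
      nlinarith
    have i2 : D * (1 / ε * (1 / N)) * Fintype.card σ ≤ δ / 2 := by
      have := ((le_max_right _ _).trans_lt hN).le
      have e : D * (1 / ε * (1 / N)) * Fintype.card σ =
          (D * (1 / ε) * Fintype.card σ * (2 / δ)) * (δ / 2) / N := by
        field_simp
      rw [e, div_le_iff₀ hN0, mul_comm (δ / 2)]
      exact mul_le_mul_of_nonneg_right this (by positivity)
    linarith
  convert! add_mem (add_mem (add_mem h1 h2) h3) (hC c hc0) using 1
  have e1 : ∑ α, B α * (C D * quadBound (ν α) ε + (F - C (eval (ν α) F))) +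
      ∑ α, B α * C (eval (ν α) F - δ) = C D * ∑ α, B α * quadBound (ν α) ε + (F - C δ) := by
    have : (F - C δ) = ∑ α, B α * (F - C δ) := by rw [← Finset.sum_mul, hBsum, one_mul]
    rw [this, Finset.mul_sum, ← Finset.sum_add_distrib, ← Finset.sum_add_distrib]
    refine Finset.sum_congr rfl fun α _ => ?_
    rw [C_sub]
    ring
  have e2 : ∑ i : σ, C (D * (1 / ε * (1 / N))) * (X i ^ 2 : MvPolynomial σ ℝ) +
      C D * ∑ i : σ, C (1 / ε * (1 / N)) * (1 - X i ^ 2) =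
      C (D * (1 / ε * (1 / N)) * Fintype.card σ) := by
    rw [Finset.mul_sum, ← Finset.sum_add_distrib, Finset.sum_congr rfl (g := fun _ =>
      C (D * (1 / ε * (1 / N)))) fun i _ => by rw [C_mul]; ring]
    simp [mul_comm]
  rw [e1, hquad, hc, C_sub, C_sub, ← e2, C_mul (a := D) (a' := ε)]
  ring

end Semiring

/-! ### Putinar's theorem for the cube -/

section Cube

/-- The cube `[-1, 1] ^ σ`. -/
def cube (σ : Type*) : Set (σ → ℝ) := {x | ∀ i, |x i| ≤ 1}

theorem mem_cube {σ : Type*} {x : σ → ℝ} : x ∈ cube σ ↔ ∀ i, |x i| ≤ 1 := Iff.rfl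

theorem isCompact_cube (σ : Type*) : IsCompact (cube σ) := by
  have h : cube σ = Set.univ.pi fun _ => Set.Icc (-1 : ℝ) 1 := by
    ext x
    simp only [mem_cube, Set.mem_univ_pi, Set.mem_Icc, abs_le]
  rw [h]
  exact isCompact_univ_pi fun _ => isCompact_Icc

theorem zero_mem_cube (σ : Type*) : (0 : σ → ℝ) ∈ cube σ := fun i => by simp

variable {σ : Type*}

theorem exists_lt_forall_cube_le {F : MvPolynomial σ ℝ} (hF : ∀ x ∈ cube σ, 0 < eval x F) :
    ∃ δ : ℝ, 0 < δ ∧ ∀ x ∈ cube σ, δ ≤ eval x F := by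
  obtain ⟨x, hx, hmin⟩ := (isCompact_cube σ).exists_isMinOn ⟨0, zero_mem_cube σ⟩
    (MvPolynomial.continuous_eval F).continuousOn
  exact ⟨_, hF x hx, fun y hy => hmin hy⟩

theorem isSumSq_C {τ : Type*} {c : ℝ} (hc : 0 ≤ c) : IsSumSq (C c : MvPolynomial τ ℝ) := by
  rw [← Real.mul_self_sqrt hc, C_mul]
  exact IsSumSq.mul_self _

/-- `s` is positive for the functional `L`: all `L (s * p ^ 2)` are nonnegative. -/
def LPos (L : MvPolynomial σ ℝ →ₗ[ℝ] ℝ) (s : MvPolynomial σ ℝ) : Prop := ∀ p, 0 ≤ L (s * p ^ 2)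

variable {L : MvPolynomial σ ℝ →ₗ[ℝ] ℝ}

theorem LPos.cauchySchwarz {s : MvPolynomial σ ℝ} (hs : LPos L s) (p q : MvPolynomial σ ℝ) :
    L (s * (p * q)) ^ 2 ≤ L (s * p ^ 2) * L (s * q ^ 2) := by
  have h : ∀ t : ℝ, 0 ≤ L (s * q ^ 2) * (t * t) + (2 * L (s * (p * q))) * t + L (s * p ^ 2) := by
    intro t
    have h1 := hs (p + C t * q)
    have e : s * (p + C t * q) ^ 2 =
        s * p ^ 2 + (2 * t) • (s * (p * q)) + (t * t) • (s * q ^ 2) := by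
      simp only [smul_eq_C_mul, C_mul, map_ofNat]
      ring
    rw [e, map_add, map_add, map_smul, map_smul, smul_eq_mul, smul_eq_mul] at h1
    linarith
  have := discrim_le_zero h
  rw [discrim] at this
  linarith

/-- The multipliers that preserve positivity for `L`. -/
def multiplierSemiring (L : MvPolynomial σ ℝ →ₗ[ℝ] ℝ) : Subsemiring (MvPolynomial σ ℝ) where
  carrier := {s | ∀ t, LPos L t → LPos L (s * t)}
  one_mem' := fun t ht => by rwa [one_mul]
  mul_mem' := fun {a b} ha hb t ht => by
    rw [mul_assoc]
    exact ha _ (hb t ht)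
  zero_mem' := fun t _ p => by simp
  add_mem' := fun {a b} ha hb t ht p => by
    rw [add_mul, add_mul, map_add]
    exact add_nonneg (ha t ht p) (hb t ht p)

theorem C_mem_multiplierSemiring {c : ℝ} (hc : 0 ≤ c) : C c ∈ multiplierSemiring L := by
  intro t ht p
  rw [mul_assoc, ← smul_eq_C_mul, map_smul, smul_eq_mul]
  exact mul_nonneg hc (ht p)

theorem sq_mem_multiplierSemiring (r : MvPolynomial σ ℝ) : r ^ 2 ∈ multiplierSemiring L := by
  intro t ht p
  convert! ht (r * p) using 2
  ring

variable [Fintype σ]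

/-- The quadratic module generated by the polynomials `1 - X i ^ 2`. -/
noncomputable def cubeQM (σ : Type*) [Fintype σ] : PointedCone ℝ (MvPolynomial σ ℝ) where
  carrier := {r | ∃ (s₀ : MvPolynomial σ ℝ) (s : σ → MvPolynomial σ ℝ), IsSumSq s₀ ∧
    (∀ i, IsSumSq (s i)) ∧ r = s₀ + ∑ i, s i * (1 - X i ^ 2)}
  zero_mem' := ⟨0, 0, .zero, fun _ => .zero, by simp⟩
  add_mem' := by
    rintro _ _ ⟨s₀, s, h₀, h, rfl⟩ ⟨t₀, t, k₀, k, rfl⟩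
    refine ⟨s₀ + t₀, s + t, h₀.add k₀, fun i => (h i).add (k i), ?_⟩
    simp only [Pi.add_apply, add_mul, Finset.sum_add_distrib]
    ring
  smul_mem' := by
    rintro c _ ⟨s₀, s, h₀, h, rfl⟩
    refine ⟨C (c : ℝ) * s₀, fun i => C (c : ℝ) * s i, (isSumSq_C c.2).mul h₀,
      fun i => IsSumSq.mul (isSumSq_C c.2) (h i), ?_⟩
    simp only [mul_assoc, ← Finset.mul_sum, ← mul_add]
    exact smul_eq_C_mul _ _

theorem mem_cubeQM {r : MvPolynomial σ ℝ} : r ∈ cubeQM σ ↔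
    ∃ (s₀ : MvPolynomial σ ℝ) (s : σ → MvPolynomial σ ℝ), IsSumSq s₀ ∧
      (∀ i, IsSumSq (s i)) ∧ r = s₀ + ∑ i, s i * (1 - X i ^ 2) := Iff.rfl

theorem IsSumSq.mem_cubeQM {r : MvPolynomial σ ℝ} (hr : IsSumSq r) : r ∈ cubeQM σ :=
  ⟨r, 0, hr, fun _ => .zero, by simp⟩

theorem one_sub_sq_mem_cubeQM (i : σ) : 1 - X i ^ 2 ∈ cubeQM σ := by
  classical
  refine ⟨0, Pi.single i 1, .zero, fun j => ?_, ?_⟩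
  · by_cases h : j = i
    · subst h
      simp
    · simp [h]
  · rw [zero_add, Finset.sum_eq_single i]
    · simp
    · intro j _ h
      simp [h]
    · simp

theorem IsSumSq.mul_mem_cubeQM {s r : MvPolynomial σ ℝ} (hs : IsSumSq s) (hr : r ∈ cubeQM σ) :
    s * r ∈ cubeQM σ := by
  obtain ⟨s₀, t, h₀, h, rfl⟩ := hr
  refine ⟨s * s₀, fun i => s * t i, hs.mul h₀, fun i => hs.mul (h i), ?_⟩
  rw [mul_add, Finset.mul_sum]
  simp only [mul_assoc]

theorem isSumSq_sq {R : Type*} [CommSemiring R] (p : R) : IsSumSq (p ^ 2) := by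
  rw [sq]
  exact IsSumSq.mul_self p

theorem C_mul_mem_cubeQM {c : ℝ} (hc : 0 ≤ c) {r : MvPolynomial σ ℝ} (hr : r ∈ cubeQM σ) :
    C c * r ∈ cubeQM σ := IsSumSq.mul_mem_cubeQM (isSumSq_C hc) hr

/-- The squares of bounded elements are bounded. -/
theorem sub_sq_mem_cubeQM {N : ℝ} (hN : 0 < N) {r : MvPolynomial σ ℝ} (h : C N - r ∈ cubeQM σ)
    (h' : C N + r ∈ cubeQM σ) : C (N ^ 2) - r ^ 2 ∈ cubeQM σ := by
  convert! C_mul_mem_cubeQM (c := 1 / (2 * N)) (by positivity)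
    (add_mem (IsSumSq.mul_mem_cubeQM (isSumSq_sq (C N + r)) h)
      (IsSumSq.mul_mem_cubeQM (isSumSq_sq (C N - r)) h')) using 1
  have e : (C (1 / (2 * N)) : MvPolynomial σ ℝ) * (2 * C N) = 1 := by
    rw [← map_ofNat (C : ℝ →+* MvPolynomial σ ℝ) 2, ← C_mul, ← C_mul,
      one_div, inv_mul_cancel₀ (by positivity), C_1]
  rw [C_pow]
  linear_combination -(C N ^ 2 - r ^ 2) * e

theorem one_add_mem_cubeQM (i : σ) (s : ℝ) (hs : s ^ 2 = 1) : 1 + C s * X i ∈ cubeQM σ := by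
  convert! C_mul_mem_cubeQM (c := 1 / 2) (by norm_num)
    (add_mem (IsSumSq.mem_cubeQM (isSumSq_sq (1 + C s * X i))) (one_sub_sq_mem_cubeQM i)) using 1
  have e : (C s : MvPolynomial σ ℝ) ^ 2 = 1 := by rw [← C_pow, hs, C_1]
  linear_combination -(1 + C s * X i) * C_half_mul_two - C (1 / 2) * X i ^ 2 * e

/-- The quadratic module of the cube is Archimedean. -/
theorem exists_C_add_mem_cubeQM (r : MvPolynomial σ ℝ) :
    ∃ N : ℝ, 0 < N ∧ C N - r ∈ cubeQM σ ∧ C N + r ∈ cubeQM σ := by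
  induction r using MvPolynomial.induction_on with
  | C a =>
    refine ⟨|a| + 1, by positivity, ?_, ?_⟩
    · rw [← C_sub]
      exact IsSumSq.mem_cubeQM (isSumSq_C (by linarith [le_abs_self a]))
    · rw [← C_add]
      exact IsSumSq.mem_cubeQM (isSumSq_C (by linarith [neg_abs_le a]))
  | add p q hp hq =>
    obtain ⟨N, hN, h1, h2⟩ := hp
    obtain ⟨N', hN', k1, k2⟩ := hq
    refine ⟨N + N', by positivity, ?_, ?_⟩
    · convert! add_mem h1 k1 using 1
      rw [C_add]
      ring
    · convert! add_mem h2 k2 using 1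
      rw [C_add]
      ring
  | mul_X p i hp =>
    obtain ⟨N, hN, h1, h2⟩ := hp
    have k1 := one_add_mem_cubeQM i 1 (by norm_num)
    have k2 := one_add_mem_cubeQM i (-1) (by norm_num)
    rw [C_1, one_mul] at k1
    rw [C_neg, C_1, neg_one_mul] at k2
    have hN1 : 0 < N + 1 := by positivity
    -- polarization: `4 p X = (p + X) ^ 2 - (p - X) ^ 2`
    have m1 : C ((N + 1) ^ 2) - (p + X i) ^ 2 ∈ cubeQM σ := by
      refine sub_sq_mem_cubeQM hN1 ?_ ?_
      · convert! add_mem h1 k2 using 1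
        rw [C_add, C_1]
        ring
      · convert! add_mem h2 k1 using 1
        rw [C_add, C_1]
        ring
    have m2 : C ((N + 1) ^ 2) - (p - X i) ^ 2 ∈ cubeQM σ := by
      refine sub_sq_mem_cubeQM hN1 ?_ ?_
      · convert! add_mem h1 k1 using 1
        rw [C_add, C_1]
        ring
      · convert! add_mem h2 k2 using 1
        rw [C_add, C_1]
        ring
    have e : (C (1 / 4) : MvPolynomial σ ℝ) * 4 = 1 := by
      rw [← map_ofNat (C : ℝ →+* MvPolynomial σ ℝ) 4, ← C_mul]
      norm_num
    refine ⟨1 / 4 * (N + 1) ^ 2, by positivity, ?_, ?_⟩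
    · convert! C_mul_mem_cubeQM (c := 1 / 4) (by norm_num)
        (add_mem m1 (IsSumSq.mem_cubeQM (isSumSq_sq (p - X i)))) using 1
      rw [C_mul]
      linear_combination p * X i * e
    · convert! C_mul_mem_cubeQM (c := 1 / 4) (by norm_num)
        (add_mem m2 (IsSumSq.mem_cubeQM (isSumSq_sq (p + X i)))) using 1
      rw [C_mul]
      linear_combination -(p * X i) * e

/-- A bounded nonnegative log-convex sequence does not increase. -/
theorem le_of_logConvex_of_bounded {a : ℕ → ℝ} (h0 : ∀ k, 0 ≤ a k) {b : ℝ} (hb : ∀ k, a k ≤ b)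
    (hlog : ∀ k, a (k + 1) ^ 2 ≤ a k * a (k + 2)) : a 1 ≤ a 0 := by
  by_contra! hlt
  have ha0 : 0 < a 0 := by
    rcases (h0 0).lt_or_eq with h | h
    · exact h
    · have := hlog 0
      rw [← h, zero_mul] at this
      nlinarith
  set q := a 1 / a 0 with hq
  have hq1 : 1 < q := (one_lt_div ha0).2 hlt
  have hstep : ∀ k, 0 < a k ∧ q * a k ≤ a (k + 1) := by
    intro k
    induction k with
    | zero => exact ⟨ha0, by rw [hq, div_mul_cancel₀ _ ha0.ne']⟩
    | succ k ih =>
      have h1 : 0 < a (k + 1) := lt_of_lt_of_le (by nlinarith [ih.1]) ih.2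
      refine ⟨h1, ?_⟩
      have h2 := hlog k
      have h3 : a k * (q * a (k + 1)) ≤ a k * a (k + 2) := by nlinarith [ih.2]
      exact le_of_mul_le_mul_left h3 ih.1
  have hgrow : ∀ k, q ^ k * a 0 ≤ a k := by
    intro k
    induction k with
    | zero => simp
    | succ k ih =>
      calc q ^ (k + 1) * a 0 = q * (q ^ k * a 0) := by ring
        _ ≤ q * a k := by gcongr
        _ ≤ a (k + 1) := (hstep k).2
  obtain ⟨k, hk⟩ := pow_unbounded_of_one_lt (b / a 0) hq1
  rw [div_lt_iff₀ ha0] at hk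
  linarith [hgrow k, hb k]

theorem map_X_pow_le (hL : ∀ r ∈ cubeQM σ, 0 ≤ L r) (i : σ) (m : ℕ) : L (X i ^ (2 * m)) ≤ L 1 := by
  induction m with
  | zero => simp
  | succ m ih =>
    refine le_trans ?_ ih
    have h := hL _ (IsSumSq.mul_mem_cubeQM (isSumSq_sq (X i ^ m)) (one_sub_sq_mem_cubeQM i))
    rw [← sub_nonneg, ← map_sub]
    convert! h using 2
    ring

/-- Positivity for `L` is preserved by multiplication with `1 - X i ^ 2`: the moments
`L (s * p ^ 2 * X i ^ (2 * k))` are log-convex and bounded in `k`, so they do not increase. -/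
theorem LPos.mul_one_sub_sq (hL : ∀ r ∈ cubeQM σ, 0 ≤ L r) {s : MvPolynomial σ ℝ} (hs : LPos L s)
    (i : σ) : LPos L ((1 - X i ^ 2) * s) := by
  intro p
  have h := le_of_logConvex_of_bounded (a := fun k => L (s * (p * X i ^ k) ^ 2))
    (b := (L ((s * p ^ 2) ^ 2) + L 1) / 2) (fun k => hs _) ?_ ?_
  · rw [← sub_nonneg, ← map_sub] at h
    convert! h using 2
    ring
  · intro k
    have h1 := hL _ (IsSumSq.mem_cubeQM (isSumSq_sq (s * p ^ 2 - X i ^ (2 * k))))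
    have h2 := map_X_pow_le hL i (2 * k)
    have e : (s * p ^ 2 - X i ^ (2 * k)) ^ 2 = (s * p ^ 2) ^ 2 - (2 : ℝ) • (s * (p * X i ^ k) ^ 2) +
        X i ^ (2 * (2 * k)) := by
      rw [smul_eq_C_mul, map_ofNat]
      ring
    rw [e, map_add, map_sub, map_smul, smul_eq_mul] at h1
    linarith
  · intro k
    have h1 := hs.cauchySchwarz (p * X i ^ k) (p * X i ^ (k + 2))
    convert! h1 using 3
    ring

theorem one_add_mem_multiplierSemiring (hL : ∀ r ∈ cubeQM σ, 0 ≤ L r) (i : σ) (s : ℝ)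
    (hs : s ^ 2 = 1) : 1 + C s * X i ∈ multiplierSemiring L := by
  have h : (1 - X i ^ 2 : MvPolynomial σ ℝ) ∈ multiplierSemiring L :=
    fun t ht => ht.mul_one_sub_sq hL i
  convert! mul_mem (C_mem_multiplierSemiring (c := 1 / 2) (by norm_num))
    (add_mem (sq_mem_multiplierSemiring (1 + C s * X i)) h) using 1
  have e : (C s : MvPolynomial σ ℝ) ^ 2 = 1 := by rw [← C_pow, hs, C_1]
  linear_combination -(1 + C s * X i) * C_half_mul_two - C (1 / 2) * X i ^ 2 * e

theorem le_map_of_le_on_cube (hL : ∀ r ∈ cubeQM σ, 0 ≤ L r) {F : MvPolynomial σ ℝ} {δ : ℝ}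
    (hF : ∀ x ∈ cube σ, δ ≤ eval x F) : δ * L 1 ≤ L F := by
  have hpos : ∀ ε : ℝ, 0 < ε → 0 ≤ L F - (δ - ε) * L 1 := by
    intro ε hε
    have hmem : F - C (δ - ε) ∈ multiplierSemiring L := by
      refine mem_of_pos_on_cube (fun c hc => C_mem_multiplierSemiring hc)
        sq_mem_multiplierSemiring (fun i => ?_) (fun i => ?_) _ hε fun x hx => ?_
      · simpa using one_add_mem_multiplierSemiring hL i 1 (by norm_num)
      · simpa [sub_eq_add_neg] using one_add_mem_multiplierSemiring hL i (-1) (by norm_num)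
      · rw [eval_sub, eval_C]
        linarith [hF x hx]
    have h1 : LPos L 1 := fun p => by
      rw [one_mul]
      exact hL _ (IsSumSq.mem_cubeQM (isSumSq_sq p))
    have h2 := hmem 1 h1 1
    rw [mul_one, one_pow, mul_one, map_sub, ← mul_one (C (δ - ε)), ← smul_eq_C_mul, map_smul,
      smul_eq_mul] at h2
    exact h2
  have h1 : 0 ≤ L 1 := hL 1 (IsSumSq.mem_cubeQM IsSumSq.one)
  by_contra! hlt
  have h2 := hpos ((δ * L 1 - L F) / (2 * (L 1 + 1))) (by
    have : 0 < δ * L 1 - L F := by linarith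
    positivity)
  have h3 : (δ * L 1 - L F) / (2 * (L 1 + 1)) * L 1 ≤ (δ * L 1 - L F) / 2 := by
    rw [div_mul_eq_mul_div, div_le_div_iff₀ (by positivity) (by norm_num)]
    nlinarith
  linarith

/-- Putinar's theorem for the cube: a polynomial that is positive on `[-1, 1] ^ σ` belongs to the
quadratic module generated by the `1 - X i ^ 2`. -/
theorem mem_cubeQM_of_pos {F : MvPolynomial σ ℝ} (hF : ∀ x ∈ cube σ, 0 < eval x F) :
    F ∈ cubeQM σ := by
  obtain ⟨δ, hδ, hle⟩ := exists_lt_forall_cube_le hF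
  by_contra hFM
  set M' : PointedCone ℝ (MvPolynomial σ ℝ) := cubeQM σ ⊔ Submodule.span _ {-F} with hM'
  -- `-1 = r - c F` with `r` in the quadratic module would put `F = (1 + r) / c` there
  have hneg : -1 ∉ M' := by
    intro h
    obtain ⟨r, hr, t, ht, hrt⟩ := Submodule.mem_sup.1 h
    obtain ⟨c, rfl⟩ := Submodule.mem_span_singleton.1 ht
    have hrt' : r = C (c : ℝ) * F - 1 := by
      have : (c • (-F) : MvPolynomial σ ℝ) = C (c : ℝ) * (-F) := smul_eq_C_mul _ _
      rw [this] at hrt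
      linear_combination hrt
    rcases c.2.lt_or_eq with hc | hc
    · apply hFM
      convert! C_mul_mem_cubeQM (c := 1 / (c : ℝ)) (by positivity)
        (add_mem hr (IsSumSq.mem_cubeQM IsSumSq.one)) using 1
      have e : (C (1 / (c : ℝ)) : MvPolynomial σ ℝ) * C (c : ℝ) = 1 := by
        rw [← C_mul, one_div, inv_mul_cancel₀ hc.ne', C_1]
      rw [hrt']
      linear_combination -F * e
    · have h1 : r = -1 := by
        rw [hrt', show ((c : ℝ)) = 0 from hc.symm]
        simp
      obtain ⟨N, hN, -, hN'⟩ := exists_C_add_mem_cubeQM F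
      apply hFM
      convert! add_mem hN' (C_mul_mem_cubeQM hN.le (h1 ▸ hr)) using 1
      ring
  obtain ⟨L, hL1, hL⟩ := riesz_extension M'
    (LinearPMap.mkSpanSingleton (1 : MvPolynomial σ ℝ) (1 : ℝ) one_ne_zero) (by
      rintro ⟨x, hx⟩ hxM
      obtain ⟨c, rfl⟩ := Submodule.mem_span_singleton.1 hx
      rw [LinearPMap.mkSpanSingleton'_apply]
      simp only [RingHom.id_apply, smul_eq_mul, mul_one]
      by_contra! hc
      apply hneg
      have hc' : 0 ≤ 1 / (-c) := by
        have : 0 < -c := by linarith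
        positivity
      have hmem := M'.smul_mem hc' hxM
      convert! hmem using 1
      change -1 = (1 / (-c)) • (c • (1 : MvPolynomial σ ℝ))
      rw [smul_smul, show 1 / (-c) * c = -1 by
        rw [one_div, inv_neg, neg_mul, inv_mul_cancel₀ hc.ne], neg_one_smul]) (by
      intro y
      obtain ⟨N, -, -, hN⟩ := exists_C_add_mem_cubeQM y
      refine ⟨⟨N • 1, Submodule.smul_mem _ _ (Submodule.mem_span_singleton_self _)⟩, ?_⟩
      refine (le_sup_left : cubeQM σ ≤ M') ?_
      convert! hN using 1
      simp [smul_eq_C_mul])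
  have hLone : L 1 = 1 := by
    rw [hL1 ⟨1, Submodule.mem_span_singleton_self _⟩]
    exact LinearPMap.mkSpanSingleton_apply _ _ _ _
  have h1 := le_map_of_le_on_cube (L := L) (fun r hr => hL r ((le_sup_left : cubeQM σ ≤ M') hr)) hle
  have h2 := hL (-F) ((le_sup_right : _ ≤ M') (Submodule.mem_span_singleton_self _))
  rw [map_neg] at h2
  rw [hLone] at h1
  linarith

end Cube

section Supported

variable {V : Type*}

/-- `r` is a sum of squares of polynomials in the variables `S`. -/
def SosIn (S : Set V) (r : MvPolynomial V ℝ) : Prop :=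
  ∃ s : supported ℝ S, IsSumSq s ∧ (s : MvPolynomial V ℝ) = r

theorem SosIn.add {S : Set V} {r t : MvPolynomial V ℝ} (hr : SosIn S r) (ht : SosIn S t) :
    SosIn S (r + t) := by
  obtain ⟨s, hs, rfl⟩ := hr
  obtain ⟨t, ht, rfl⟩ := ht
  exact ⟨s + t, hs.add ht, rfl⟩

theorem SosIn.zero {S : Set V} : SosIn S (0 : MvPolynomial V ℝ) := ⟨0, .zero, rfl⟩

theorem sosIn_coe_sq {S : Set V} (a : supported ℝ S) : SosIn S ((a : MvPolynomial V ℝ) ^ 2) :=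
  ⟨a * a, IsSumSq.mul_self a, by
    rw [sq]
    rfl⟩

theorem sosIn_sq {S : Set V} {r : MvPolynomial V ℝ} (hr : r ∈ supported ℝ S) : SosIn S (r ^ 2) := by
  lift r to supported ℝ S using hr
  exact sosIn_coe_sq r

theorem IsSumSq.sosIn_rename {S : Finset V} {r : MvPolynomial S ℝ} (hr : IsSumSq r) :
    SosIn (S : Set V) (rename Subtype.val r) := by
  induction hr with
  | zero =>
    rw [map_zero]
    exact SosIn.zero
  | sq_add a _ ih =>
    rw [map_add, map_mul, ← sq]
    refine (sosIn_sq ?_).add ih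
    rw [supported_eq_range_rename]
    exact ⟨a, rfl⟩

/-- Putinar's theorem for the cube, within the polynomials in the variables `S`. -/
theorem exists_sos_of_pos_on_cube (S : Finset V) {h : MvPolynomial V ℝ}
    (hS : h ∈ supported ℝ (S : Set V)) (hpos : ∀ x ∈ cube V, 0 < eval x h) :
    ∃ (s₀ : MvPolynomial V ℝ) (s : V → MvPolynomial V ℝ), SosIn (S : Set V) s₀ ∧
      (∀ i, SosIn (S : Set V) (s i)) ∧ h = s₀ + ∑ i ∈ S, s i * (1 - X i ^ 2) := by
  classical
  obtain ⟨h', rfl⟩ : ∃ h' : MvPolynomial S ℝ, rename (Subtype.val : S → V) h' = h := by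
    rw [supported_eq_range_rename] at hS
    exact hS
  have hpos' : ∀ x ∈ cube S, 0 < eval x h' := by
    intro x hx
    have h1 := hpos (fun v => if hv : v ∈ S then x ⟨v, hv⟩ else 0) (fun v => by
      by_cases hv : v ∈ S
      · simpa [hv] using hx ⟨v, hv⟩
      · simp [hv])
    have e : (fun v => if hv : v ∈ S then x ⟨v, hv⟩ else 0) ∘ (Subtype.val : S → V) = x := by
      ext ⟨v, hv⟩
      simp [hv]
    rwa [eval_rename, e] at h1
  obtain ⟨s₀, s, h₀, hs, he⟩ := mem_cubeQM.1 (mem_cubeQM_of_pos hpos')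
  refine ⟨rename Subtype.val s₀,
    fun v => if hv : v ∈ S then rename Subtype.val (s ⟨v, hv⟩) else 0,
    IsSumSq.sosIn_rename h₀, fun i => ?_, ?_⟩
  · dsimp only
    split_ifs with hv
    · exact IsSumSq.sosIn_rename (hs ⟨i, hv⟩)
    · exact SosIn.zero
  · rw [he, ← Finset.sum_coe_sort S, map_add, map_sum]
    congr 1
    refine Finset.sum_congr rfl fun i _ => ?_
    dsimp only
    rw [dif_pos i.2, map_mul, map_sub, map_one, map_pow, rename_X]

end Supported

/-! ### Splitting a sparse positive polynomial along a chordal graph -/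

section Split

variable {V : Type*}

/-- The Weierstrass approximation theorem on the cube, for functions of the variables in `N`. -/
theorem exists_supported_near (N : Finset V) {φ : (V → ℝ) → ℝ} (hφ : Continuous φ)
    (hdep : ∀ x y : V → ℝ, (∀ i ∈ N, x i = y i) → φ x = φ y) {ε : ℝ} (hε : 0 < ε) :
    ∃ P ∈ supported ℝ (N : Set V), ∀ x ∈ cube V, |eval x P - φ x| < ε := by
  classical
  let Φ : MvPolynomial N ℝ →ₐ[ℝ] C(N → ℝ, ℝ) := aeval fun i => ⟨fun x => x i, continuous_apply i⟩
  have hΦ : ∀ p x, Φ p x = eval x p := by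
    intro p x
    induction p using MvPolynomial.induction_on with
    | C a => simp [Φ]
    | add p q hp hq => rw [map_add, map_add, ContinuousMap.add_apply, hp, hq]
    | mul_X p i hp =>
      rw [map_mul, map_mul, ContinuousMap.mul_apply, hp, eval_X]
      simp [Φ]
  have hsep : Φ.range.SeparatesPoints := by
    intro x y hxy
    obtain ⟨i, hi⟩ := Function.ne_iff.1 hxy
    refine ⟨_, ⟨Φ (X i), ⟨X i, rfl⟩, rfl⟩, ?_⟩
    change Φ (X i) x ≠ Φ (X i) y
    rwa [hΦ, hΦ, eval_X, eval_X]
  let e : (N → ℝ) → V → ℝ := fun x v => if hv : v ∈ N then x ⟨v, hv⟩ else 0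
  have he : Continuous e := by
    refine continuous_pi fun v => ?_
    by_cases hv : v ∈ N
    · simpa only [e, hv, dif_pos] using continuous_apply (⟨v, hv⟩ : N)
    · simpa only [e, hv, dif_neg, not_false_eq_true] using continuous_const
  obtain ⟨_, ⟨P, rfl⟩, hP⟩ :=
    ContinuousMap.exists_mem_subalgebra_near_continuous_of_isCompact_of_separatesPoints hsep
      ⟨fun x => φ (e x), hφ.comp he⟩ (isCompact_cube N) hε
  refine ⟨rename Subtype.val P, ?_, fun x hx => ?_⟩
  · rw [supported_eq_range_rename]
    exact ⟨P, rfl⟩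
  · have h := hP (x ∘ Subtype.val) fun i => hx i
    have h2 : φ (e (x ∘ Subtype.val)) = φ x := hdep _ _ fun i hi => by simp [e, hi]
    rw [eval_rename, ← h2, ← hΦ]
    exact h

theorem eval_congr_of_supported {S : Set V} {F : MvPolynomial V ℝ} (hF : F ∈ supported ℝ S)
    {x y : V → ℝ} (h : ∀ i ∈ S, x i = y i) : eval x F = eval y F :=
  eval₂Hom_congr' rfl (fun i hi _ => h i (mem_supported.1 hF hi)) rfl

/-- Every monomial of `F` lives on a clique of `G`. -/
def CliqueSupported (G : SimpleGraph V) (F : MvPolynomial V ℝ) : Prop :=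
  ∀ s ∈ F.support, G.IsClique (s.support : Set V)

variable {G : SimpleGraph V}

theorem cliqueSupported_of_supported {S : Set V} (hS : G.IsClique S) {F : MvPolynomial V ℝ}
    (hF : F ∈ supported ℝ S) : CliqueSupported G F := by
  intro s hs
  refine Set.Pairwise.mono (fun i hi => mem_supported.1 hF ?_) hS
  exact (mem_vars_iff_mem_support _).2 ⟨s, hs, hi⟩

theorem CliqueSupported.add {F F' : MvPolynomial V ℝ} (hF : CliqueSupported G F)
    (hF' : CliqueSupported G F') : CliqueSupported G (F + F') := by
  classical
  intro s hs
  rcases Finset.mem_union.1 (support_add hs) with h | h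
  · exact hF s h
  · exact hF' s h

theorem CliqueSupported.neg {F : MvPolynomial V ℝ} (hF : CliqueSupported G F) :
    CliqueSupported G (-F) := by
  intro s hs
  exact hF s (by rwa [support_neg] at hs)

theorem CliqueSupported.sum {ι : Type*} (T : Finset ι) {F : ι → MvPolynomial V ℝ}
    (hF : ∀ i ∈ T, CliqueSupported G (F i)) : CliqueSupported G (∑ i ∈ T, F i) := by
  classical
  induction T using Finset.induction_on with
  | empty =>
    intro s hs
    simp at hs
  | insert i T hi ih =>
    rw [Finset.sum_insert hi]
    exact (hF i (Finset.mem_insert_self _ _)).add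
      (ih fun j hj => hF j (Finset.mem_insert_of_mem hj))

theorem sum_filter_monomial_mem {A : Set V} (F : MvPolynomial V ℝ) (p : (V →₀ ℕ) → Prop)
    [DecidablePred p] (h : ∀ s ∈ F.support, p s → (s.support : Set V) ⊆ A) :
    ∑ s ∈ F.support.filter p, monomial s (coeff s F) ∈ supported ℝ A := by
  refine sum_mem fun s hs => mem_supported.2 fun i hi => ?_
  obtain ⟨hs, hp⟩ := Finset.mem_filter.1 hs
  rw [vars_monomial (mem_support_iff.1 hs)] at hi
  exact h s hs hp hi

/-- A polynomial that is positive on the cube and whose monomials live on cliques of the chordal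
graph `G` is a sum of polynomials that are positive on the cube and whose variables form a clique.
This is stated as an induction principle: such a polynomial has every additive property `Q` that
holds for positive polynomials in the variables of a clique.  The proof eliminates a simplicial vertex `v`: if
`F = F₁ + F₂` where `F₁` collects the monomials that contain `v`, then the minimum of `F₁` with
respect to `v` is a continuous function of the neighbours of `v`, and a polynomial slightly below it
is subtracted from `F₁` and added to `F₂`. -/
theorem IsChordal.induction_on_positive [Finite V] (hG : IsChordal G)
    {Q : MvPolynomial V ℝ → Prop} (hadd : ∀ F F', Q F → Q F' → Q (F + F'))
    (hclique : ∀ S : Finset V, G.IsClique (S : Set V) → ∀ F ∈ supported ℝ (S : Set V),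
      (∀ x ∈ cube V, 0 < eval x F) → Q F) (A : Finset V) :
    ∀ F ∈ supported ℝ (A : Set V), CliqueSupported G F → (∀ x ∈ cube V, 0 < eval x F) → Q F := by
  classical
  induction A using Finset.strongInduction with
  | H A ih =>
  intro F hFA hFG hpos
  rcases A.eq_empty_or_nonempty with rfl | hA
  · exact hclique ∅ (by simp) F hFA hpos
  obtain ⟨v, hvA, -, hv⟩ := hG.exists_simplicial A ∅ (Finset.empty_ssubset.2 hA) (by simp)
  set N : Finset V := A.filter fun c => G.Adj v c with hN
  have hvN : v ∉ N := fun h => (Finset.mem_filter.1 h).2.ne rfl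
  have hNcl : G.IsClique (N : Set V) := by
    refine Set.Pairwise.mono (fun c hc => ?_) hv
    exact Finset.mem_filter.1 (Finset.mem_coe.1 hc)
  have hvNcl : G.IsClique ((insert v N : Finset V) : Set V) := by
    rw [Finset.coe_insert]
    exact hNcl.insert fun c hc _ => (Finset.mem_filter.1 (Finset.mem_coe.1 hc)).2
  have hsuppA : ∀ s ∈ F.support, (s.support : Set V) ⊆ A := fun s hs i hi =>
    mem_supported.1 hFA ((mem_vars_iff_mem_support _).2 ⟨s, hs, hi⟩)
  set F₁ := ∑ s ∈ F.support.filter (fun s => v ∈ s.support), monomial s (coeff s F) with hF₁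
  set F₂ := ∑ s ∈ F.support.filter (fun s => v ∉ s.support), monomial s (coeff s F) with hF₂
  have hF : F = F₁ + F₂ := by
    rw [hF₁, hF₂, Finset.sum_filter_add_sum_filter_not]
    exact F.as_sum
  have hF₁s : F₁ ∈ supported ℝ ((insert v N : Finset V) : Set V) := by
    refine sum_filter_monomial_mem F _ fun s hs hvs i hi => ?_
    rw [Finset.coe_insert]
    by_cases hiv : i = v
    · exact Or.inl hiv
    · exact Or.inr (Finset.mem_filter.2 ⟨hsuppA s hs hi, hFG s hs hvs hi (Ne.symm hiv)⟩)
  have hF₂s : F₂ ∈ supported ℝ ((A.erase v : Finset V) : Set V) := by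
    refine sum_filter_monomial_mem F _ fun s hs hvs i hi => ?_
    refine Finset.mem_erase.2 ⟨?_, hsuppA s hs hi⟩
    rintro rfl
    exact hvs hi
  have hF₂G : CliqueSupported G F₂ := by
    have h : F₂ = F + -F₁ := by rw [hF]; ring
    rw [h]
    exact hFG.add (cliqueSupported_of_supported hvNcl hF₁s).neg
  -- the minimum of `F₁` over the values of the variable `v`
  set φ : (V → ℝ) → ℝ := fun x =>
    sInf ((fun t => eval (Function.update x v t) F₁) '' Set.Icc (-1 : ℝ) 1) with hφ
  have hcont : Continuous fun y : (V → ℝ) × ℝ => eval (Function.update y.1 v y.2) F₁ :=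
    (MvPolynomial.continuous_eval F₁).comp (continuous_fst.update v continuous_snd)
  have hφc : Continuous φ := isCompact_Icc.continuous_sInf hcont
  have hφmin : ∀ x, ∃ t ∈ Set.Icc (-1 : ℝ) 1, φ x = eval (Function.update x v t) F₁ ∧
      ∀ t' ∈ Set.Icc (-1 : ℝ) 1, φ x ≤ eval (Function.update x v t') F₁ := by
    intro x
    obtain ⟨t, ht, h1, h2⟩ := (isCompact_Icc (a := (-1 : ℝ)) (b := 1)).exists_sInf_image_eq_and_le
      ⟨0, by norm_num⟩ (hcont.comp (Continuous.prodMk_right x)).continuousOn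
    exact ⟨t, ht, h1, fun t' ht' => h1.le.trans (h2 t' ht')⟩
  have hdep : ∀ x y : V → ℝ, (∀ i ∈ N, x i = y i) → φ x = φ y := by
    intro x y hxy
    have h : ∀ t, eval (Function.update x v t) F₁ = eval (Function.update y v t) F₁ := by
      intro t
      refine eval_congr_of_supported hF₁s fun i hi => ?_
      rcases Finset.mem_insert.1 (Finset.mem_coe.1 hi) with rfl | hi
      · simp
      · have : i ≠ v := fun h => hvN (h ▸ hi)
        simp [this, hxy i hi]
    simp only [hφ, h]
  have hupd : ∀ x ∈ cube V, ∀ t ∈ Set.Icc (-1 : ℝ) 1, Function.update x v t ∈ cube V := by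
    intro x hx t ht i
    by_cases hi : i = v
    · subst hi
      simpa [abs_le] using ht
    · simpa [hi] using hx i
  obtain ⟨δ, hδ, hle⟩ := exists_lt_forall_cube_le hpos
  obtain ⟨P, hPN, hP⟩ := exists_supported_near N (φ := fun x => φ x - δ / 2)
    (hφc.sub continuous_const) (fun x y h => by rw [hdep x y h]) (half_pos hδ)
  have hPA : P ∈ supported ℝ ((A.erase v : Finset V) : Set V) := by
    refine supported_mono (fun c hc => ?_) hPN
    exact Finset.mem_erase.2 ⟨fun h => hvN (h ▸ hc), (Finset.mem_filter.1 hc).1⟩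
  have hQ₁ : Q (F₁ - P) := by
    refine hclique _ hvNcl _ (sub_mem hF₁s (supported_mono ?_ hPN)) fun x hx => ?_
    · rw [Finset.coe_insert]
      exact Set.subset_insert _ _
    · obtain ⟨-, -, -, h⟩ := hφmin x
      have h1 := h (x v) (abs_le.1 (hx v))
      rw [Function.update_eq_self] at h1
      have h2 := abs_lt.1 (hP x hx)
      rw [eval_sub]
      linarith [h2.2]
  have hQ₂ : Q (F₂ + P) := by
    refine ih _ (Finset.erase_ssubset hvA) _ (add_mem hF₂s hPA)
      (hF₂G.add (cliqueSupported_of_supported hNcl hPN)) fun x hx => ?_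
    obtain ⟨t, ht, h, -⟩ := hφmin x
    have h1 := hle _ (hupd x hx t ht)
    have h2 := abs_lt.1 (hP x hx)
    have h3 : eval (Function.update x v t) F₂ = eval x F₂ := by
      refine eval_congr_of_supported hF₂s fun i hi => ?_
      rw [Function.update_of_ne (Finset.mem_erase.1 (Finset.mem_coe.1 hi)).1]
    rw [hF, eval_add, h3, ← h] at h1
    rw [eval_add]
    linarith [h2.1]
  have := hadd _ _ hQ₁ hQ₂
  rwa [show F₁ - P + (F₂ + P) = F by rw [hF]; ring] at this

end Split

/-! ### Penalizing constraints -/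

section Penalty

variable {V : Type*}

theorem mul_one_sub_pow_le {t : ℝ} (h0 : 0 ≤ t) (h1 : t ≤ 1) (N : ℕ) :
    t * (1 - t) ^ N ≤ 1 / (N + 1) := by
  have h : t * ∑ i ∈ Finset.range (N + 1), (1 - t) ^ i = 1 - (1 - t) ^ (N + 1) := by
    have := mul_neg_geom_sum (1 - t) (N + 1)
    rw [← this]
    ring
  have h2 : ((N : ℝ) + 1) * (1 - t) ^ N ≤ ∑ i ∈ Finset.range (N + 1), (1 - t) ^ i := by
    have := Finset.card_nsmul_le_sum (Finset.range (N + 1)) (fun i => (1 - t) ^ i) ((1 - t) ^ N)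
      fun i hi => pow_le_pow_of_le_one (by linarith) (by linarith)
        (Nat.lt_succ_iff.1 (Finset.mem_range.1 hi))
    simpa using this
  rw [le_div_iff₀ (by positivity)]
  have h3 : 0 ≤ (1 - t) ^ (N + 1) := pow_nonneg (by linarith) _
  nlinarith [mul_le_mul_of_nonneg_left h2 h0]

/-- A single constraint can be penalized: the multiplier is `c (1 - b g) ^ (2 N)`, which is large
where `g` is negative, and for which `c (1 - b g) ^ (2 N) g` is small where `g` is nonnegative. -/
theorem exists_penalty {B : Set (V → ℝ)} (hB : IsCompact B) (F g : MvPolynomial V ℝ)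
    (hF : ∀ x ∈ B, 0 ≤ eval x g → 0 < eval x F) :
    ∃ q : Polynomial ℝ, ∀ x ∈ B, 0 < eval x (F - Polynomial.aeval g q ^ 2 * g) := by
  have hFc := MvPolynomial.continuous_eval F
  have hgc := MvPolynomial.continuous_eval g
  -- on the feasible part, `F ≥ ε`
  obtain ⟨ε, hε, hFε⟩ : ∃ ε : ℝ, 0 < ε ∧ ∀ x ∈ B, 0 ≤ eval x g → ε ≤ eval x F := by
    rcases (B ∩ {x | 0 ≤ eval x g}).eq_empty_or_nonempty with h | h
    · exact ⟨1, one_pos, fun x hx hgx => (h.subset ⟨hx, hgx⟩).elim⟩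
    · obtain ⟨y, hy, hmin⟩ := (hB.inter_right (isClosed_le continuous_const hgc)).exists_isMinOn h
        hFc.continuousOn
      exact ⟨_, hF y hy.1 hy.2, fun x hx hgx => hmin ⟨hx, hgx⟩⟩
  -- where `F ≤ 0`, `g ≤ -η`
  obtain ⟨η, hη, hgη⟩ : ∃ η : ℝ, 0 < η ∧ ∀ x ∈ B, eval x F ≤ 0 → eval x g ≤ -η := by
    rcases (B ∩ {x | eval x F ≤ 0}).eq_empty_or_nonempty with h | h
    · exact ⟨1, one_pos, fun x hx hgx => (h.subset ⟨hx, hgx⟩).elim⟩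
    · obtain ⟨y, hy, hmax⟩ := (hB.inter_right (isClosed_le hFc continuous_const)).exists_isMaxOn h
        hgc.continuousOn
      have hgy : eval y g < 0 := by
        by_contra! hcon
        exact (hF y hy.1 hcon).not_ge hy.2
      exact ⟨-eval y g, by linarith, fun x hx hFx => by
        rw [neg_neg]
        exact hmax ⟨hx, hFx⟩⟩
  obtain ⟨M, hM⟩ := hB.exists_bound_of_continuousOn hFc.continuousOn
  obtain ⟨b', hb'⟩ := hB.exists_bound_of_continuousOn hgc.continuousOn
  set a : ℝ := |b'| + 1 with ha
  have ha0 : 0 < a := by positivity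
  have hga : ∀ x ∈ B, |eval x g| ≤ a := fun x hx =>
    (hb' x hx).trans ((le_abs_self _).trans (by linarith))
  set c : ℝ := (|M| + 1) / η with hc
  have hc0 : 0 < c := by positivity
  obtain ⟨N, hN⟩ := exists_nat_gt (c * a / ε)
  rw [div_lt_iff₀ hε] at hN
  refine ⟨Polynomial.C (Real.sqrt c) * (1 - Polynomial.C (1 / a) * Polynomial.X) ^ N,
    fun x hx => ?_⟩
  set y := eval x g with hy
  have heval : eval x (F - Polynomial.aeval g (Polynomial.C (Real.sqrt c) *
      (1 - Polynomial.C (1 / a) * Polynomial.X) ^ N) ^ 2 * g) =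
      eval x F - c * (1 - y / a) ^ (2 * N) * y := by
    simp only [map_mul, map_pow, map_sub, map_one, Polynomial.aeval_C, Polynomial.aeval_X,
      MvPolynomial.algebraMap_eq, eval_C, ← hy, mul_pow, Real.sq_sqrt hc0.le]
    ring
  rw [heval]
  have hya := abs_le.1 (hga x hx)
  rcases le_or_gt 0 y with hy0 | hy0
  · have h1 := hFε x hx hy0
    have h2 := mul_one_sub_pow_le (t := y / a) (by positivity) ((div_le_one ha0).2 hya.2) (2 * N)
    have h3 : c * (1 - y / a) ^ (2 * N) * y < ε := by
      calc c * (1 - y / a) ^ (2 * N) * y = c * a * (y / a * (1 - y / a) ^ (2 * N)) := by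
            field_simp
        _ ≤ c * a * (1 / (((2 * N : ℕ) : ℝ) + 1)) := by gcongr
        _ < ε := by
            rw [mul_one_div, div_lt_iff₀ (by positivity)]
            push_cast
            have : (0 : ℝ) ≤ N := by positivity
            nlinarith
    linarith
  · have hq : 1 ≤ (1 - y / a) ^ (2 * N) := by
      refine one_le_pow₀ ?_
      have : y / a < 0 := div_neg_of_neg_of_pos hy0 ha0
      linarith
    have h1 : c * -y ≤ c * (1 - y / a) ^ (2 * N) * -y := by
      refine mul_le_mul_of_nonneg_right ?_ (by linarith)
      nlinarith
    rcases le_or_gt (eval x F) 0 with hF0 | hF0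
    · have h2 := hgη x hx hF0
      have h3 : c * η ≤ c * -y := mul_le_mul_of_nonneg_left (by linarith) hc0.le
      have h4 : c * η = |M| + 1 := by rw [hc, div_mul_cancel₀ _ hη.ne']
      have h5 := (abs_le.1 (hM x hx)).1
      have h6 := le_abs_self M
      linarith
    · have h2 : 0 < c * -y := mul_pos hc0 (by linarith)
      linarith

/-- Finitely many constraints can be penalized simultaneously. -/
theorem exists_penalties {B : Set (V → ℝ)} (hB : IsCompact B) {ι : Type*} (T : Finset ι)
    (g : ι → MvPolynomial V ℝ) :
    ∀ F : MvPolynomial V ℝ, (∀ x ∈ B, (∀ i ∈ T, 0 ≤ eval x (g i)) → 0 < eval x F) →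
    ∃ q : ι → Polynomial ℝ, ∀ x ∈ B,
      0 < eval x (F - ∑ i ∈ T, Polynomial.aeval (g i) (q i) ^ 2 * g i) := by
  classical
  induction T using Finset.induction_on generalizing B with
  | empty => exact fun F hF => ⟨0, fun x hx => by simpa using hF x hx⟩
  | insert i T hi ih =>
    intro F hF
    have hB' : IsCompact (B ∩ {x | ∀ j ∈ T, 0 ≤ eval x (g j)}) := by
      refine hB.inter_right ?_
      simp only [Set.ofPred_forall]
      exact isClosed_biInter fun j _ =>
        isClosed_le continuous_const (MvPolynomial.continuous_eval (g j))
    obtain ⟨q₀, hq₀⟩ := exists_penalty hB' F (g i) fun x hx hgx => hF x hx.1 fun j hj => by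
      rcases Finset.mem_insert.1 hj with rfl | hj
      · exact hgx
      · exact hx.2 j hj
    obtain ⟨q, hq⟩ := ih hB _ fun x hx hgx => hq₀ x ⟨hx, hgx⟩
    refine ⟨Function.update q i q₀, fun x hx => ?_⟩
    have h := hq x hx
    rw [sub_sub] at h
    rw [Finset.sum_insert hi, Function.update_self]
    rwa [Finset.sum_congr rfl fun j hj => by
      rw [Function.update_of_ne (ne_of_mem_of_not_mem hj hi)]]

end Penalty

/-! ### Homogenization -/

section Homogenization

theorem eval_smul_of_isHomogeneous {σ : Type*} {φ : MvPolynomial σ ℝ} {k : ℕ}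
    (hφ : φ.IsHomogeneous k) (c : ℝ) (x : σ → ℝ) : eval (c • x) φ = c ^ k * eval x φ := by
  rw [eval_eq, eval_eq, Finset.mul_sum]
  refine Finset.sum_congr rfl fun s hs => ?_
  have hdeg : ∑ i ∈ s.support, s i = k := by
    have := hφ (mem_support_iff.1 hs)
    rw [Finsupp.weight_apply, Finsupp.sum] at this
    simpa using this
  simp only [Pi.smul_apply, smul_eq_mul, mul_pow, Finset.prod_mul_distrib,
    Finset.prod_pow_eq_pow_sum, hdeg]
  ring

variable {n : ℕ}

theorem eval_homog (f : MvPolynomial (Fin n) ℝ) (y : Fin (n + 1) → ℝ) :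
    eval y (homog f) = ∑ i ∈ Finset.range (f.totalDegree + 1),
      y 0 ^ (f.totalDegree - i) * eval (fun j => y j.succ) (homogeneousComponent i f) := by
  simp only [homog, map_sum, map_mul, map_pow, eval_X, eval_rename]
  rfl

theorem eval_homog_of_ne_zero (f : MvPolynomial (Fin n) ℝ) {y : Fin (n + 1) → ℝ} (hy : y 0 ≠ 0) :
    eval y (homog f) = y 0 ^ f.totalDegree * eval (fun j => y j.succ / y 0) f := by
  rw [eval_homog]
  have hf : eval (fun j => y j.succ / y 0) f = ∑ i ∈ Finset.range (f.totalDegree + 1),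
      eval (fun j => y j.succ / y 0) (homogeneousComponent i f) := by
    rw [← map_sum, sum_homogeneousComponent]
  rw [hf, Finset.mul_sum]
  refine Finset.sum_congr rfl fun i hi => ?_
  have h : (fun j : Fin n => y j.succ) = y 0 • fun j : Fin n => y j.succ / y 0 := by
    ext j
    rw [Pi.smul_apply, smul_eq_mul, mul_div_cancel₀ _ hy]
  conv_lhs => rw [h]
  rw [eval_smul_of_isHomogeneous (homogeneousComponent_isHomogeneous i f), ← mul_assoc, ← pow_add,
    Nat.sub_add_cancel (Nat.lt_succ_iff.1 (Finset.mem_range.1 hi))]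

theorem eval_homog_of_eq_zero (f : MvPolynomial (Fin n) ℝ) {y : Fin (n + 1) → ℝ} (hy : y 0 = 0) :
    eval y (homog f) = eval (fun j => y j.succ) (topForm f) := by
  rw [eval_homog, Finset.sum_range_succ, Finset.sum_eq_zero, zero_add, Nat.sub_self, pow_zero,
    one_mul, topForm]
  intro i hi
  rw [hy, zero_pow (Nat.sub_ne_zero_of_lt (Finset.mem_range.1 hi)), zero_mul]

theorem homog_mem_supported {S : Set (Fin (n + 1))} (h0 : 0 ∈ S) (f : MvPolynomial (Fin n) ℝ)
    (hf : ∀ i ∈ f.vars, i.succ ∈ S) : homog f ∈ supported ℝ S := by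
  refine sum_mem fun i _ => mul_mem (pow_mem (X_mem_supported.2 h0) _) (mem_supported.2 ?_)
  intro j hj
  obtain ⟨k, hk, rfl⟩ := mem_vars_rename _ _ hj
  refine hf k ?_
  obtain ⟨s, hs, hks⟩ := (mem_vars_iff_mem_support _).1 hk
  rw [support_homogeneousComponent] at hs
  exact (mem_vars_iff_mem_support _).2 ⟨s, (Finset.mem_filter.1 hs).1, hks⟩

variable {m : ℕ} {f : MvPolynomial (Fin n) ℝ} {g : Fin m → MvPolynomial (Fin n) ℝ}

/-- Dehomogenization maps the points of `K̃` with `x₀ > 0` to `K`. -/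
theorem div_mem_feasibleSet {y : Fin (n + 1) → ℝ} (hy : y ∈ homogSet g) (h0 : 0 < y 0) :
    (fun j : Fin n => y j.succ / y 0) ∈ feasibleSet g := by
  intro j
  have h := hy.1 j
  rw [eval_homog_of_ne_zero _ h0.ne'] at h
  exact nonneg_of_mul_nonneg_right h (by positivity)

/-- For `γ < f_min`, the form `f̃ - γ x₀ ^ d` is positive on `K̃`: for `x₀ > 0` because `f > γ` on
`K`, and for `x₀ = 0` by positivity at infinity.  If `d = 0`, the term `γ x₀ ^ d` does not vanish
for `x₀ = 0`; there closedness at infinity provides a point with `x₀ > 0`, i.e. a point of `K`. -/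
theorem homog_sub_pos (hclosed : ClosedAtInfinity g) (hpos : PositiveAtInfinity f g) {γ : ℝ}
    (hγ : (γ : EReal) < fMin f g) {y : Fin (n + 1) → ℝ} (hy : y ∈ homogSet g) :
    0 < eval y (homog f) - γ * y 0 ^ f.totalDegree := by
  have hK : ∀ z ∈ feasibleSet g, γ < eval z f := fun z hz =>
    EReal.coe_lt_coe_iff.1 (hγ.trans_le (iInf₂_le z hz))
  have hpos0 : ∀ z ∈ homogSet g, 0 < z 0 → 0 < eval z (homog f) - γ * z 0 ^ f.totalDegree := by
    intro z hz h0
    rw [eval_homog_of_ne_zero _ h0.ne', mul_comm γ, ← mul_sub]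
    exact mul_pos (by positivity) (sub_pos.2 (hK _ (div_mem_feasibleSet hz h0)))
  rcases hy.2.1.lt_or_eq with h0 | h0
  · exact hpos0 y hy h0
  rcases Nat.eq_zero_or_pos f.totalDegree with hd | hd
  · have hy' := hy
    rw [hclosed] at hy'
    obtain ⟨z, hz, hz0⟩ := closure_nonempty_iff.1 ⟨y, hy'⟩
    have h := hpos0 z hz hz0
    rw [eval_homog, hd] at h ⊢
    simpa [homogeneousComponent_zero] using h
  · rw [← h0, zero_pow hd.ne', mul_zero, sub_zero, eval_homog_of_eq_zero f h0.symm]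
    refine hpos _ (fun j => ?_) ?_
    · rw [← eval_homog_of_eq_zero _ h0.symm]
      exact hy.1 j
    · have := hy.2.2
      rw [Fin.sum_univ_succ, ← h0] at this
      simpa using this

/-- The point of `K̃` that lies over a point of `K`. -/
theorem exists_mem_homogSet {z : Fin n → ℝ} (hz : z ∈ feasibleSet g) :
    ∃ y ∈ homogSet g, 0 < y 0 ∧ ∀ j : Fin n, y j.succ / y 0 = z j := by
  set r : ℝ := Real.sqrt (1 + ∑ j, z j ^ 2) with hr
  have hsum : 0 ≤ ∑ j, z j ^ 2 := Finset.sum_nonneg fun _ _ => sq_nonneg _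
  have hr0 : 0 < r := Real.sqrt_pos.2 (by linarith)
  have hr2 : r ^ 2 = 1 + ∑ j, z j ^ 2 := Real.sq_sqrt (by linarith)
  have hdiv : ∀ j : Fin n, z j / r / (1 / r) = z j := fun j => by field_simp
  refine ⟨Fin.cons (1 / r) fun j => z j / r, ⟨fun j => ?_, ?_, ?_⟩, ?_, fun j => ?_⟩
  · rw [eval_homog_of_ne_zero]
    · simp only [Fin.cons_zero, Fin.cons_succ, hdiv]
      exact mul_nonneg (by positivity) (hz j)
    · rw [Fin.cons_zero]
      positivity
  · rw [Fin.cons_zero]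
    positivity
  · rw [Fin.sum_univ_succ]
    simp only [Fin.cons_zero, Fin.cons_succ, div_pow]
    rw [← Finset.sum_div, ← add_div, one_pow, ← hr2, div_self (by positivity)]
  · rw [Fin.cons_zero]
    positivity
  · simp only [Fin.cons_zero, Fin.cons_succ, hdiv]

end Homogenization

/-! ### The feasible set of the reformulation -/

section Reformulation

variable {n m p : ℕ} {f : MvPolynomial (Fin n) ℝ} {g : Fin m → MvPolynomial (Fin n) ℝ}
  {x : Fin p → Finset (Fin n)}

theorem eval_homogU (f : MvPolynomial (Fin n) ℝ) (u : UVar n p → ℝ) :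
    eval u (homogU p f) = eval (fun i => u (Sum.inl i)) (homog f) := by
  rw [homogU, eval_rename]
  rfl

theorem eval_x0 (u : UVar n p → ℝ) : eval u (x0 n p) = u (Sum.inl 0) := by
  rw [x0, eval_X]

theorem eval_eqPoly_some (u : UVar n p → ℝ) (l : Fin p) : eval u (eqPoly x (some l)) =
    ∑ i ∈ x l, 1 / (freq x i : ℝ) * u (Sum.inl i.succ) ^ 2 + 1 / (p : ℝ) * u (Sum.inl 0) ^ 2 +
      u (Sum.inr l) ^ 2 - 1 := by
  simp [eqPoly, eval_x0]

theorem eval_eqPoly_none (u : UVar n p → ℝ) :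
    eval u (eqPoly x none) = ∑ l, u (Sum.inr l) ^ 2 - ((p : ℝ) - 1) := by
  simp [eqPoly]

theorem freq_pos {i : Fin n} {l : Fin p} (h : i ∈ x l) : 0 < freq x i :=
  Finset.card_pos.2 ⟨l, Finset.mem_filter.2 ⟨Finset.mem_univ _, h⟩⟩

theorem sum_weighted (hx : ∀ i, ∃ l, i ∈ x l) (a : Fin n → ℝ) :
    ∑ l, ∑ i ∈ x l, 1 / (freq x i : ℝ) * a i = ∑ i, a i := by
  rw [Finset.sum_comm' (t' := Finset.univ) (s' := fun i => Finset.univ.filter fun l => i ∈ x l)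
    (by simp)]
  refine Finset.sum_congr rfl fun i _ => ?_
  obtain ⟨l, hl⟩ := hx i
  have h : (freq x i : ℝ) ≠ 0 := by exact_mod_cast (freq_pos hl).ne'
  rw [Finset.sum_const, nsmul_eq_mul, ← mul_assoc]
  change (freq x i : ℝ) * (1 / (freq x i : ℝ)) * a i = a i
  rw [mul_one_div_cancel h, one_mul]

theorem sum_eqPoly (hp : 0 < p) (hx : ∀ i, ∃ l, i ∈ x l) (u : UVar n p → ℝ) :
    ∑ l, eval u (eqPoly x (some l)) =
      ∑ i : Fin (n + 1), u (Sum.inl i) ^ 2 + ∑ l, u (Sum.inr l) ^ 2 - p := by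
  have hp' : (p : ℝ) ≠ 0 := by exact_mod_cast hp.ne'
  simp only [eval_eqPoly_some, Finset.sum_sub_distrib, Finset.sum_add_distrib]
  rw [sum_weighted hx fun i => u (Sum.inl i.succ) ^ 2, Fin.sum_univ_succ]
  simp only [Finset.sum_const, Finset.card_univ, Fintype.card_fin, nsmul_eq_mul]
  field_simp
  ring

theorem fst_mem_homogSet (hp : 0 < p) (hx : ∀ i, ∃ l, i ∈ x l) {u : UVar n p → ℝ}
    (hu : u ∈ sparseHomogSet g x) : (fun i => u (Sum.inl i)) ∈ homogSet g := by
  refine ⟨fun j => ?_, ?_, ?_⟩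
  · have h := hu.1 (.inr (.inr j))
    rwa [ineqPoly, eval_homogU] at h
  · have h := hu.1 (.inl ())
    rwa [ineqPoly, eval_x0] at h
  · have h1 := sum_eqPoly hp hx u
    rw [Finset.sum_eq_zero fun l _ => hu.2 (some l)] at h1
    have h2 := hu.2 none
    rw [eval_eqPoly_none] at h2
    linarith

theorem exists_lift_mem_sparseHomogSet (hp : 0 < p) (hx : ∀ i, ∃ l, i ∈ x l)
    {y : Fin (n + 1) → ℝ} (hy : y ∈ homogSet g) :
    ∃ u ∈ sparseHomogSet g x, ∀ i, u (Sum.inl i) = y i := by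
  obtain ⟨hg, hy0, hsum⟩ := hy
  have hp1 : (1 : ℝ) ≤ p := by exact_mod_cast hp
  set s : Fin p → ℝ := fun l =>
    ∑ i ∈ x l, 1 / (freq x i : ℝ) * y i.succ ^ 2 + 1 / (p : ℝ) * y 0 ^ 2 with hs
  have hs0 : ∀ l, 0 ≤ s l := fun l => by
    have : 0 ≤ ∑ i ∈ x l, 1 / (freq x i : ℝ) * y i.succ ^ 2 :=
      Finset.sum_nonneg fun i _ => by positivity
    positivity
  have hs1 : ∀ l, s l ≤ 1 := by
    intro l
    rw [← hsum, Fin.sum_univ_succ, add_comm (y 0 ^ 2)]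
    refine add_le_add ?_ ?_
    rotate_left
    · have : 1 / (p : ℝ) ≤ 1 := (div_le_one (by linarith)).2 hp1
      nlinarith [sq_nonneg (y 0)]
    · refine (Finset.sum_le_sum (g := fun i : Fin n => y i.succ ^ 2) fun i hi => ?_).trans
        (Finset.sum_le_univ_sum_of_nonneg fun i => sq_nonneg _)
      have h1 : (1 : ℝ) ≤ freq x i := by exact_mod_cast freq_pos hi
      have : 1 / (freq x i : ℝ) ≤ 1 := (div_le_one (by linarith)).2 h1
      nlinarith [sq_nonneg (y i.succ)]
  set u : UVar n p → ℝ := Sum.elim y fun l => Real.sqrt (1 - s l) with hu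
  have hw : ∀ l, u (Sum.inr l) ^ 2 = 1 - s l := fun l => Real.sq_sqrt (by linarith [hs1 l])
  have heq : ∀ l, eval u (eqPoly x (some l)) = 0 := by
    intro l
    rw [eval_eqPoly_some, hw]
    simp only [hu, hs, Sum.elim_inl]
    ring
  refine ⟨u, ⟨?_, ?_⟩, fun i => rfl⟩
  · rintro (_ | v | j)
    · rw [ineqPoly, eval_x0]
      exact hy0
    · rw [ineqPoly]
      simp only [map_sub, map_one, map_pow, eval_X, sub_nonneg]
      rcases v with i | l
      · rw [← hsum]
        exact Finset.single_le_sum (f := fun i => y i ^ 2) (fun i _ => sq_nonneg _)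
          (Finset.mem_univ i)
      · rw [hw]
        linarith [hs0 l]
    · rw [ineqPoly, eval_homogU]
      exact hg j
  · rintro (_ | l)
    · have h := sum_eqPoly hp hx u
      rw [Finset.sum_eq_zero fun l _ => heq l] at h
      rw [eval_eqPoly_none]
      have h2 : ∑ i : Fin (n + 1), u (Sum.inl i) ^ 2 = 1 := hsum
      linarith
    · exact heq l

end Reformulation

/-! ### The variable `x₀` and the maximal cliques -/

section Cliques

variable {n m p : ℕ} {f : MvPolynomial (Fin n) ℝ} {g : Fin m → MvPolynomial (Fin n) ℝ}
  {x : Fin p → Finset (Fin n)}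

theorem mem_vars_of_eval_single_ne {V : Type*} [DecidableEq V] {F : MvPolynomial V ℝ} {v : V}
    (h : eval (Pi.single v 1) F ≠ eval 0 F) : v ∈ F.vars := by
  by_contra hv
  refine h (eval_congr_of_supported (mem_supported_vars F) fun i hi => ?_)
  have : i ≠ v := fun hiv => hv (hiv ▸ hi)
  simp [this]

theorem x0_mem_vars_eqPoly (hp : 0 < p) (l : Fin p) :
    (Sum.inl 0 : UVar n p) ∈ (eqPoly x (some l)).vars := by
  classical
  refine mem_vars_of_eval_single_ne ?_
  have hp' : (p : ℝ) ≠ 0 := by exact_mod_cast hp.ne'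
  rw [eval_eqPoly_some, eval_eqPoly_some]
  simp [hp']

theorem inl_mem_vars_eqPoly {l : Fin p} {i : Fin n} (hi : i ∈ x l) :
    (Sum.inl i.succ : UVar n p) ∈ (eqPoly x (some l)).vars := by
  classical
  refine mem_vars_of_eval_single_ne ?_
  have h : (freq x i : ℝ) ≠ 0 := by exact_mod_cast (freq_pos hi).ne'
  rw [eval_eqPoly_some, eval_eqPoly_some]
  simp [Pi.single_apply, hi, h, ite_pow, (Fin.succ_ne_zero i).symm]

theorem inr_mem_vars_eqPoly (l : Fin p) :
    (Sum.inr l : UVar n p) ∈ (eqPoly x (some l)).vars := by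
  classical
  refine mem_vars_of_eval_single_ne ?_
  rw [eval_eqPoly_some, eval_eqPoly_some]
  simp

/-- `x₀` occurs in every weighted sphere constraint, so it is adjacent to all other variables. -/
theorem cspGraph_adj_x0 (hp : 0 < p) (hx : ∀ i, ∃ l, i ∈ x l) {v : UVar n p}
    (hv : v ≠ Sum.inl 0) : (cspGraph f g x).Adj (Sum.inl 0) v := by
  refine ⟨hv.symm, Or.inr (Or.inl ?_)⟩
  rcases v with i | l
  · obtain ⟨j, rfl⟩ := Fin.exists_succ_eq.2 fun h : i = 0 => hv (congrArg Sum.inl h)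
    obtain ⟨l, hl⟩ := hx j
    exact ⟨some l, x0_mem_vars_eqPoly hp l, inl_mem_vars_eqPoly hl⟩
  · exact ⟨some l, x0_mem_vars_eqPoly hp l, inr_mem_vars_eqPoly l⟩

variable {G : SimpleGraph (UVar n p)} {q : ℕ} {u : Fin q → Finset (UVar n p)}

theorem IsMaxCliqueList.isClique (hu : IsMaxCliqueList G u) (l : Fin q) :
    G.IsClique (u l : Set (UVar n p)) := ((hu.2 _).2 ⟨l, rfl⟩).prop

theorem IsMaxCliqueList.exists_subset (hu : IsMaxCliqueList G u) {S : Set (UVar n p)}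
    (hS : G.IsClique S) : ∃ l, S ⊆ u l := by
  obtain ⟨T, hST, hT⟩ := (Set.toFinite {S : Set (UVar n p) | G.IsClique S}).exists_le_maximal hS
  obtain ⟨l, rfl⟩ := (hu.2 T).1 hT
  exact ⟨l, hST⟩

theorem IsMaxCliqueList.x0_mem (hu : IsMaxCliqueList G u) (hp : 0 < p) (hx : ∀ i, ∃ l, i ∈ x l)
    (hG : cspGraph f g x ≤ G) (l : Fin q) : Sum.inl 0 ∈ u l := by
  have h := (hu.2 _).2 ⟨l, rfl⟩
  have hins : G.IsClique (insert (Sum.inl 0) (u l : Set (UVar n p))) :=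
    h.prop.insert fun v _ hv => hG (cspGraph_adj_x0 hp hx hv.symm)
  exact h.le_of_ge hins (Set.subset_insert _ _) (Set.mem_insert _ _)

theorem mem_vars_rename_of_mem_vars {σ τ : Type*} {φ : σ → τ} (hφ : Function.Injective φ)
    {r : MvPolynomial σ ℝ} {i : σ} (hi : i ∈ r.vars) : φ i ∈ (rename φ r).vars := by
  obtain ⟨s, hs, his⟩ := (mem_vars_iff_mem_support _).1 hi
  refine (mem_vars_iff_mem_support _).2 ⟨s.mapDomain φ, ?_, ?_⟩
  · rwa [mem_support_iff, coeff_rename_mapDomain φ hφ, ← mem_support_iff]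
  · rwa [Finsupp.mem_support_iff, Finsupp.mapDomain_apply hφ, ← Finsupp.mem_support_iff]

theorem homogU_mem_supported {S : Set (UVar n p)} (h0 : Sum.inl 0 ∈ S) {r : MvPolynomial (Fin n) ℝ}
    (hr : rename (fun i : Fin n => (Sum.inl i.succ : UVar n p)) r ∈ supported ℝ S) :
    homogU p r ∈ supported ℝ S := by
  have hinj : Function.Injective fun i : Fin n => (Sum.inl i.succ : UVar n p) := fun i j h =>
    Fin.succ_injective _ (Sum.inl_injective h)
  have h : homog r ∈ supported ℝ (Sum.inl ⁻¹' S) := homog_mem_supported h0 r fun i hi =>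
    mem_supported.1 hr (mem_vars_rename_of_mem_vars hinj hi)
  rw [mem_supported]
  intro v hv
  obtain ⟨i, hi, rfl⟩ := mem_vars_rename _ _ hv
  exact mem_supported.1 h hi

theorem cliqueSupported_objective (hG : cspGraph f g x ≤ G) (γ : ℝ) :
    CliqueSupported G (homogU p f - C γ * x0 n p ^ f.totalDegree) := by
  rw [sub_eq_add_neg]
  refine CliqueSupported.add ?_ (CliqueSupported.neg ?_)
  · intro s hs a ha b hb hab
    exact hG ⟨hab, Or.inl ⟨s, hs, ha, hb⟩⟩
  · refine cliqueSupported_of_supported (S := {Sum.inl 0}) (by simp) ?_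
    have h : x0 n p ∈ supported ℝ {Sum.inl 0} := X_mem_supported.2 rfl
    rw [← smul_eq_C_mul]
    exact Subalgebra.smul_mem _ (pow_mem h _) γ

end Cliques

/-! ### The sparse quadratic module and its truncations -/

section Module

variable {n m p q : ℕ} {f : MvPolynomial (Fin n) ℝ} {g : Fin m → MvPolynomial (Fin n) ℝ}
  {x : Fin p → Finset (Fin n)} {u : Fin q → Finset (UVar n p)} {J : Fin m → Fin q}
  {I : Option (Fin p) → Fin q}

/-- The indices of the inequality constraints that belong to the block `l`. -/
def blockIneq (u : Fin q → Finset (UVar n p)) (J : Fin m → Fin q) (l : Fin q) :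
    Finset (Unit ⊕ (UVar n p ⊕ Fin m)) :=
  ({()} : Finset Unit).disjSum ((u l).disjSum (Finset.univ.filter fun j => J j = l))

/-- Membership in the sum over all blocks of the ideals and the quadratic modules, without a bound
on the degrees. -/
def SparseModule (g : Fin m → MvPolynomial (Fin n) ℝ) (x : Fin p → Finset (Fin n))
    (u : Fin q → Finset (UVar n p)) (J : Fin m → Fin q) (I : Option (Fin p) → Fin q)
    (r : MvPolynomial (UVar n p) ℝ) : Prop :=
  ∃ (τ : Option (Fin p) → MvPolynomial (UVar n p) ℝ) (s₀ : Fin q → MvPolynomial (UVar n p) ℝ)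
    (s : Fin q → Unit ⊕ (UVar n p ⊕ Fin m) → MvPolynomial (UVar n p) ℝ),
    (∀ c, τ c ∈ supported ℝ (u (I c) : Set (UVar n p))) ∧
    (∀ l, SosIn (u l : Set (UVar n p)) (s₀ l)) ∧
    (∀ l c, SosIn (u l : Set (UVar n p)) (s l c)) ∧
    r = ∑ c, τ c * eqPoly x c + ∑ l, (s₀ l + ∑ c ∈ blockIneq u J l, s l c * ineqPoly p g c)

theorem SparseModule.add {r r' : MvPolynomial (UVar n p) ℝ} (h : SparseModule g x u J I r)
    (h' : SparseModule g x u J I r') : SparseModule g x u J I (r + r') := by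
  obtain ⟨τ, s₀, s, hτ, hs₀, hs, rfl⟩ := h
  obtain ⟨τ', s₀', s', hτ', hs₀', hs', rfl⟩ := h'
  refine ⟨fun c => τ c + τ' c, fun l => s₀ l + s₀' l, fun l c => s l c + s' l c,
    fun c => add_mem (hτ c) (hτ' c), fun l => (hs₀ l).add (hs₀' l),
    fun l c => (hs l c).add (hs' l c), ?_⟩
  simp only [add_mul, Finset.sum_add_distrib]
  ring

theorem SparseModule.zero : SparseModule g x u J I 0 :=
  ⟨0, 0, 0, fun _ => zero_mem _, fun _ => .zero, fun _ _ => .zero, by simp⟩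

theorem SparseModule.sum {ι : Type*} (T : Finset ι) {r : ι → MvPolynomial (UVar n p) ℝ}
    (h : ∀ i ∈ T, SparseModule g x u J I (r i)) : SparseModule g x u J I (∑ i ∈ T, r i) := by
  classical
  induction T using Finset.induction_on with
  | empty => exact .zero
  | insert i T hi ih =>
    rw [Finset.sum_insert hi]
    exact (h i (Finset.mem_insert_self _ _)).add
      (ih fun j hj => h j (Finset.mem_insert_of_mem hj))

theorem sparseModule_mul_eqPoly (c : Option (Fin p)) {τ : MvPolynomial (UVar n p) ℝ}
    (hτ : τ ∈ supported ℝ (u (I c) : Set (UVar n p))) :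
    SparseModule g x u J I (τ * eqPoly x c) := by
  classical
  refine ⟨fun c' => if c' = c then τ else 0, 0, 0, fun c' => ?_, fun _ => .zero,
    fun _ _ => .zero, ?_⟩
  · dsimp only
    split_ifs with h
    · rwa [h]
    · exact zero_mem _
  · simp

theorem sparseModule_sos (l : Fin q) {s : MvPolynomial (UVar n p) ℝ}
    (hs : SosIn (u l : Set (UVar n p)) s) : SparseModule g x u J I s := by
  classical
  refine ⟨0, fun l' => if l' = l then s else 0, 0, fun _ => zero_mem _, fun l' => ?_,
    fun _ _ => .zero, ?_⟩
  · dsimp only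
    split_ifs with h
    · rwa [h]
    · exact .zero
  · simp

theorem sparseModule_sos_mul_ineqPoly (l : Fin q) {s : MvPolynomial (UVar n p) ℝ}
    (hs : SosIn (u l : Set (UVar n p)) s) {c : Unit ⊕ (UVar n p ⊕ Fin m)}
    (hc : c ∈ blockIneq u J l) : SparseModule g x u J I (s * ineqPoly p g c) := by
  classical
  refine ⟨0, 0, fun l' c' => if l' = l then (if c' = c then s else 0) else 0, fun _ => zero_mem _,
    fun _ => .zero, fun l' c' => ?_, ?_⟩
  · dsimp only
    split_ifs with h
    · rwa [h]
    · exact .zero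
    · exact .zero
  · rw [Finset.sum_eq_single l]
    · rw [Finset.sum_eq_single c]
      · simp
      · intro c' _ h
        simp [h]
      · exact fun h => (h hc).elim
    · intro l' _ h
      simp [h]
    · simp

theorem eventually_mem_polysLE {V : Type*} {S : Set V} {r : MvPolynomial V ℝ}
    (hr : r ∈ supported ℝ S) (d : ℕ) :
    ∀ᶠ k : ℕ in Filter.atTop, r ∈ polysLE S (2 * (k : ℤ) - d) := by
  filter_upwards [Filter.eventually_ge_atTop (r.totalDegree + d)] with k hk
  exact ⟨hr, fun _ => by omega⟩

theorem SosIn.mem_supported {V : Type*} {S : Set V} {r : MvPolynomial V ℝ} (hr : SosIn S r) :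
    r ∈ supported ℝ S := by
  obtain ⟨s, -, rfl⟩ := hr
  exact s.2

theorem eventually_mem_sosLE {V : Type*} {S : Set V} {r : MvPolynomial V ℝ}
    (hr : SosIn S r) (d : ℕ) :
    ∀ᶠ k : ℕ in Filter.atTop, r ∈ sosLE S (2 * (k : ℤ) - d) :=
  (eventually_mem_polysLE hr.mem_supported d).mono fun _ h => ⟨hr, h⟩

/-- Every element of the sparse quadratic module lies in the truncations of large order. -/
theorem SparseModule.eventually_sosFeasible {γ : ℝ}
    (h : SparseModule g x u J I (homogU p f - C γ * x0 n p ^ f.totalDegree)) :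
    ∀ᶠ k : ℕ in Filter.atTop, SOSFeasible f g x u J I k γ := by
  classical
  obtain ⟨τ, s₀, s, hτ, hs₀, hs, he⟩ := h
  have h1 : ∀ᶠ k : ℕ in Filter.atTop, ∀ c,
      τ c ∈ polysLE (u (I c) : Set (UVar n p)) (2 * (k : ℤ) - (eqPoly x c).totalDegree) :=
    Filter.eventually_all.2 fun c => eventually_mem_polysLE (hτ c) _
  have h2 : ∀ᶠ k : ℕ in Filter.atTop, ∀ l, s₀ l ∈ sosLE (u l : Set (UVar n p)) (2 * (k : ℤ)) :=
    Filter.eventually_all.2 fun l => by simpa using eventually_mem_sosLE (hs₀ l) 0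
  have h3 : ∀ᶠ k : ℕ in Filter.atTop, ∀ l c, s l c ∈ sosLE (u l : Set (UVar n p))
      (2 * (k : ℤ) - 2 * (((ineqPoly p g c).totalDegree + 1) / 2 : ℕ)) :=
    Filter.eventually_all.2 fun l => Filter.eventually_all.2 fun c => by
      simpa only [Nat.cast_mul, Nat.cast_ofNat] using
        eventually_mem_sosLE (hs l c) (2 * (((ineqPoly p g c).totalDegree + 1) / 2))
  filter_upwards [h1, h2, h3] with k h1 h2 h3
  refine ⟨fun l => ∑ c ∈ Finset.univ.filter (fun c => I c = l), τ c * eqPoly x c,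
    fun l => s₀ l + ∑ c ∈ blockIneq u J l, s l c * ineqPoly p g c,
    fun l => ⟨τ, fun c hc => ?_, rfl⟩, fun l => ⟨s₀ l, s l, h2 l, fun c _ => h3 l c, rfl⟩, ?_⟩
  · have := h1 c
    rwa [(Finset.mem_filter.1 hc).2] at this
  · rw [he, Finset.sum_fiberwise Finset.univ I fun c => τ c * eqPoly x c]

theorem SosIn.eval_nonneg {V : Type*} {S : Set V} {r : MvPolynomial V ℝ} (hr : SosIn S r)
    (y : V → ℝ) : 0 ≤ eval y r := by
  obtain ⟨s, hs, rfl⟩ := hr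
  induction hs with
  | zero => simp
  | sq_add a _ ih =>
    change 0 ≤ eval y ((a : MvPolynomial V ℝ) * a + _)
    rw [map_add, map_mul]
    exact add_nonneg (mul_self_nonneg _) ih

/-- The relaxations are valid: a feasible `γ` is a lower bound for `f` on `K`. -/
theorem SOSFeasible.le_fMin (hp : 0 < p) (hx : ∀ i, ∃ l, i ∈ x l) {k : ℕ} {γ : ℝ}
    (h : SOSFeasible f g x u J I k γ) : (γ : EReal) ≤ fMin f g := by
  refine le_iInf₂ fun z hz => EReal.coe_le_coe_iff.2 ?_
  obtain ⟨y, hy, hy0, hyz⟩ := exists_mem_homogSet hz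
  obtain ⟨v, hv, hvy⟩ := exists_lift_mem_sparseHomogSet hp hx hy
  obtain ⟨a, b, ha, hb, he⟩ := h
  have ha0 : ∀ l, eval v (a l) = 0 := by
    intro l
    obtain ⟨τ, -, hτ⟩ := ha l
    rw [hτ, map_sum]
    exact Finset.sum_eq_zero fun c _ => by rw [map_mul, hv.2, mul_zero]
  have hb0 : ∀ l, 0 ≤ eval v (b l) := by
    intro l
    obtain ⟨s₀, s, h₀, hs, hbs⟩ := hb l
    rw [hbs, map_add, map_sum]
    refine add_nonneg (SosIn.eval_nonneg h₀.1 v) (Finset.sum_nonneg fun c hc => ?_)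
    rw [map_mul]
    exact mul_nonneg (SosIn.eval_nonneg (hs c hc).1 v) (hv.1 c)
  have h := congrArg (eval v) he
  rw [map_add, map_sum, map_sum, Finset.sum_eq_zero fun l _ => ha0 l, zero_add, map_sub, map_mul,
    map_pow, eval_C, eval_homogU, eval_x0] at h
  simp only [hvy] at h
  rw [eval_homog_of_ne_zero _ hy0.ne', funext hyz, mul_comm γ, ← mul_sub] at h
  have h1 : 0 ≤ y 0 ^ f.totalDegree * (eval z f - γ) :=
    h ▸ Finset.sum_nonneg fun l _ => hb0 l
  exact sub_nonneg.1 (nonneg_of_mul_nonneg_right h1 (by positivity))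

theorem sosValue_le_fMin (hp : 0 < p) (hx : ∀ i, ∃ l, i ∈ x l) (k : ℕ) :
    sosValue f g x u J I k ≤ fMin f g := by
  unfold sosValue
  exact iSup₂_le fun γ hγ => SOSFeasible.le_fMin hp hx hγ

theorem SOSFeasible.le_sosValue {k : ℕ} {γ : ℝ} (h : SOSFeasible f g x u J I k γ) :
    (γ : EReal) ≤ sosValue f g x u J I k := by
  unfold sosValue
  exact le_iSup₂_of_le γ h le_rfl

theorem aeval_mem_supported {V : Type*} {S : Set V} {r : MvPolynomial V ℝ}
    (hr : r ∈ supported ℝ S) (w : Polynomial ℝ) : Polynomial.aeval r w ∈ supported ℝ S :=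
  Algebra.adjoin_le (Set.singleton_subset_iff.2 hr) (Polynomial.aeval_mem_adjoin_singleton ℝ r)

/-- A clique-sparse polynomial that is positive on the feasible set of the reformulation lies in the
sparse quadratic module: penalizing all constraints but `1 - u_i ^ 2 ≥ 0` makes it positive on the
whole cube, where it splits along the cliques, and Putinar's theorem for the cube applies to each
part. -/
theorem sparseModule_of_pos (hp : 0 < p) (hx : ∀ i, ∃ l, i ∈ x l) {G : SimpleGraph (UVar n p)}
    (hG : cspGraph f g x ≤ G) (hchordal : IsChordal G) (hu : IsMaxCliqueList G u)
    (hJ : ∀ j, rename (fun i : Fin n => (Sum.inl i.succ : UVar n p)) (g j) ∈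
      supported ℝ (u (J j) : Set (UVar n p)))
    (hI : ∀ c, eqPoly x c ∈ supported ℝ (u (I c) : Set (UVar n p)))
    {F : MvPolynomial (UVar n p) ℝ} (hFG : CliqueSupported G F)
    (hF : ∀ v ∈ sparseHomogSet g x, 0 < eval v F) : SparseModule g x u J I F := by
  have h0 : ∀ l, Sum.inl 0 ∈ u l := hu.x0_mem hp hx hG
  have hgJ : ∀ j, homogU p (g j) ∈ supported ℝ (u (J j) : Set (UVar n p)) := fun j =>
    homogU_mem_supported (h0 _) (hJ j)
  obtain ⟨l₀, -⟩ := hu.exists_subset (S := ∅) (by simp)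
  have hx0 : x0 n p ∈ supported ℝ (u l₀ : Set (UVar n p)) := X_mem_supported.2 (h0 l₀)
  -- an equality constraint `h = 0` is the inequality `-h ^ 2 ≥ 0`
  let c : Unit ⊕ (Option (Fin p) ⊕ Fin m) → MvPolynomial (UVar n p) ℝ :=
    Sum.elim (fun _ => x0 n p) (Sum.elim (fun i => -eqPoly x i ^ 2) fun j => homogU p (g j))
  let b : Unit ⊕ (Option (Fin p) ⊕ Fin m) → Fin q := Sum.elim (fun _ => l₀) (Sum.elim I J)
  have hcb : ∀ i, c i ∈ supported ℝ (u (b i) : Set (UVar n p)) := by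
    rintro (_ | i | j)
    · exact hx0
    · exact neg_mem (pow_mem (hI i) 2)
    · exact hgJ j
  obtain ⟨w, hw⟩ := exists_penalties (isCompact_cube (UVar n p)) Finset.univ c F (by
    intro v hv hc
    refine hF v ⟨?_, fun i => ?_⟩
    · rintro (_ | a | j)
      · exact hc (.inl ()) (Finset.mem_univ _)
      · have h := hv a
        rw [ineqPoly, map_sub, map_one, map_pow, eval_X, sub_nonneg]
        exact (sq_le_one_iff_abs_le_one _).2 h
      · exact hc (.inr (.inr j)) (Finset.mem_univ _)
    · have h : 0 ≤ eval v (-eqPoly x i ^ 2) := hc (.inr (.inl i)) (Finset.mem_univ _)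
      rw [map_neg, map_pow] at h
      exact pow_eq_zero_iff two_ne_zero |>.1 (le_antisymm (by linarith) (sq_nonneg _)))
  have hws : ∀ i, Polynomial.aeval (c i) (w i) ∈ supported ℝ (u (b i) : Set (UVar n p)) :=
    fun i => aeval_mem_supported (hcb i) _
  have hpen : SparseModule g x u J I (∑ i, Polynomial.aeval (c i) (w i) ^ 2 * c i) := by
    refine SparseModule.sum _ fun i _ => ?_
    have hsq := sosIn_sq (hws i)
    rcases i with _ | i | j
    · exact sparseModule_sos_mul_ineqPoly (c := .inl ()) l₀ hsq (by simp [blockIneq])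
    · have h := sparseModule_mul_eqPoly (g := g) (x := x) (u := u) (J := J) (I := I) i
        (neg_mem (mul_mem (pow_mem (hws (.inr (.inl i))) 2) (hI i)))
      convert! h using 1
      simp only [c, Sum.elim_inl, Sum.elim_inr]
      ring
    · exact sparseModule_sos_mul_ineqPoly (c := .inr (.inr j)) (J j) hsq (by simp [blockIneq])
  have hrest : SparseModule g x u J I (F - ∑ i, Polynomial.aeval (c i) (w i) ^ 2 * c i) := by
    refine hchordal.induction_on_positive (Q := SparseModule g x u J I) (fun _ _ => .add) ?_
      Finset.univ _ ?_ ?_ hw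
    · intro S hS r hr hpos
      obtain ⟨l, hl⟩ := hu.exists_subset hS
      obtain ⟨s₀, s, h₀, hs, rfl⟩ := exists_sos_of_pos_on_cube (u l) (supported_mono hl hr) hpos
      refine (sparseModule_sos l h₀).add (SparseModule.sum _ fun i hi => ?_)
      exact sparseModule_sos_mul_ineqPoly (c := .inr (.inl i)) l (hs i) (by simp [blockIneq, hi])
    · rw [Finset.coe_univ, supported_univ]
      exact Algebra.mem_top
    · rw [sub_eq_add_neg]
      refine hFG.add (CliqueSupported.neg (CliqueSupported.sum _ fun i _ => ?_))
      exact cliqueSupported_of_supported (hu.isClique (b i))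
        (mul_mem (pow_mem (hws i) 2) (hcb i))
  have := hrest.add hpen
  rwa [sub_add_cancel] at this

end Module

end SparsePOP

theorem mainTheorem2 {n m p q : ℕ} (hp : 0 < p)
    (f : MvPolynomial (Fin n) ℝ) (g : Fin m → MvPolynomial (Fin n) ℝ)
    (hfmin : ⊥ < SparsePOP.fMin f g)
    (hclosed : SparsePOP.ClosedAtInfinity g)
    (hpos : SparsePOP.PositiveAtInfinity f g)
    (x : Fin p → Finset (Fin n)) (hx : SparsePOP.IsCSP f g x)
    (G : SimpleGraph (SparsePOP.UVar n p))
    (hG : SparsePOP.cspGraph f g x ≤ G) (hchordal : SparsePOP.IsChordal G)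
    (u : Fin q → Finset (SparsePOP.UVar n p)) (hu : SparsePOP.IsMaxCliqueList G u)
    (J : Fin m → Fin q)
    (hJ : ∀ j, MvPolynomial.rename (fun i : Fin n => (Sum.inl i.succ : SparsePOP.UVar n p)) (g j) ∈
      MvPolynomial.supported ℝ (u (J j) : Set (SparsePOP.UVar n p)))
    (I : Option (Fin p) → Fin q)
    (hI : ∀ c, SparsePOP.eqPoly x c ∈
      MvPolynomial.supported ℝ (u (I c) : Set (SparsePOP.UVar n p))) :
    Filter.Tendsto (fun k : ℕ => SparsePOP.sosValue f g x u J I k) Filter.atTop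
      (nhds (SparsePOP.fMin f g)) := by
  open SparsePOP in
  refine tendsto_order.2 ⟨fun a ha => ?_, fun b hb => ?_⟩
  · obtain ⟨γ, haγ, hγ⟩ := EReal.lt_iff_exists_real_btwn.1 ha
    have hmod : SparseModule g x u J I (homogU p f - C γ * x0 n p ^ f.totalDegree) := by
      refine sparseModule_of_pos hp hx.1 hG hchordal hu hJ hI (cliqueSupported_objective hG γ)
        fun v hv => ?_
      rw [map_sub, map_mul, map_pow, eval_C, eval_homogU, eval_x0]
      exact homog_sub_pos hclosed hpos hγ (fst_mem_homogSet hp hx.1 hv)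
    filter_upwards [hmod.eventually_sosFeasible] with k hk
    exact haγ.trans_le hk.le_sosValue
  · exact Filter.Eventually.of_forall fun k => (sosValue_le_fMin hp hx.1 k).trans_lt hb
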